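/- Let $n\ge 1$ candidates be given. A qualification ordering is a permutation $\sigma=(\sigma_1,\dots,\sigma_n)$ of the candidates, $\sigma_1$ being the best; a time ordering $\tau=(\tau_1,\dots,\tau_n)$ gives the order in which they appear and is uniformly random. A stopping time $M$ assigns to $(\sigma,\tau)$ a time $t=M(\sigma,\tau)\in\{1,\dots,n\}$, the decision to stop at $t$ depending only on the relative qualifications of $\tau_1,\dots,\tau_t$; it selects the candidate $CM(\sigma,\tau)=\tau_{M(\sigma,\tau)}$. Let $t_n$ be the smallest positive integer $t$ with $\frac1t+\frac1{t+1}+\dots+\frac1{n-1}\le 1$. Let $M^*$ be the secretary algorithm with threshold $t_n$: it stops at the first time $k\ge t_n$ at which $\tau_k$ is the best among $\tau_1,\dots,\tau_k$, and at time $n$ if there is no such $k$. The blind choice $\tilde M$ always stops at time $1$. For $p\in[0,1]$ the $p$-mix $M$ of $M^*$ and $\tilde M$ tosses a coin, independent of $\tau$, plays $M^*$ with probability $p$ and $\tilde M$ with probability $1-p$. Put $q_{k,n}=\mathbb P[CM(\sigma,\tau)=\sigma_k]$ and $a_k=\sum_{s=k}^{\infty}\frac1s\left(1-\frac1e\right)^s$.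 For $1\le l\le n-1$ let $d_l(\sigma,\rho)$ be the least $k$ such that $\sigma=\pi_1\circ\dots\circ\pi_k\circ\rho$, where each $\pi_i$ is a transposition of two candidates whose positions in $\pi_{i+1}\circ\dots\circ\pi_k\circ\rho$ are at most $l$ apart. A randomized stopping algorithm $A$ is $(\varepsilon,\delta)$-differentially private with respect to $d_l$ if $\mathbb P[CA(\sigma,\tau)\in S]\le e^{\varepsilon}\,\mathbb P[CA(\rho,\tau)\in S]+\delta$ for every set $S$ of candidates and all qualification orderings $\sigma,\rho$ with $d_l(\sigma,\rho)\le 1$. Let $l\ge 1$, $p\in(0,1]$ and $\varepsilon\ge 0$ be constants. (i) Let $n\ge 7$, $n>l$, let $\sigma$ be a qualification ordering, and let $\delta$ be a real number with $$\delta\ \ge\ \begin{cases} q_{1,n}-e^{\varepsilon}q_{l+1,n} & \text{if } \varepsilon<\ln\left(q_{1,n}/q_{l+1,n}\right),\\ 0 & \text{if } \varepsilon\ge\ln\left(q_{1,n}/q_{l+1,n}\right).\end{cases}$$ Then the $p$-mix $M$ is $(\varepsilon,\delta)$-differentially private with respect to $d_l$. (ii) For any choice of a qualification ordering for each $n$,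 as $n\to\infty$, $$q_{1,n}-e^{\varepsilon}q_{l+1,n}\ \longrightarrow\ \frac pe\left(1-a_{l+1}e^{\varepsilon}\right),$$ and, if $a_{l+1}e^{\varepsilon}\ne 1$, then $q_{1,n}-e^{\varepsilon}q_{l+1,n}\sim\frac pe\left(1-a_{l+1}e^{\varepsilon}\right)$, i.e. the ratio of the two sides tends to $1$. -/

import Mathlib

namespace SecretaryDP

open MeasureTheory ProbabilityTheory

/-! The candidates are the elements of `Fin n`. An ordering of the candidates is a permutation of
`Fin n`, read as the map from positions to candidates. For a qualification ordering `σ`, `σ 0` is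
the best candidate; for a time ordering `τ`, `τ 0` is the candidate that appears first.
Positions and times are 0-based in `Fin n`. -/

/-- An ordering of `n` candidates: position `i` is occupied by candidate `σ i`. -/
abbrev CandOrder (n : ℕ) : Type := Equiv.Perm (Fin n)

/-- The 1-based rank of the candidate `c` in the qualification ordering `σ`, so that
`rank σ c = k` says that `c` is the `k`-th best candidate `σ_k`. -/
def rank {n : ℕ} (σ : CandOrder n) (c : Fin n) : ℕ := (σ.symm c : ℕ) + 1

/-- A stopping time: the decision to stop at time `t` depends only on the relative order (with
respect to qualifications) of the candidates that appeared up to time `t`. -/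
structure StoppingTime (n : ℕ) where
  /-- The time at which the player stops. -/
  time : CandOrder n → CandOrder n → Fin n
  /-- The decision depends only on the relative ranks observed so far. -/
  adapted : ∀ σ τ σ' τ' : CandOrder n,
    (∀ i j : Fin n, i ≤ time σ τ → j ≤ time σ τ →
      (rank σ (τ i) < rank σ (τ j) ↔ rank σ' (τ' i) < rank σ' (τ' j))) →
    time σ' τ' = time σ τ

/-- The blind choice: always stop at the first candidate. -/
def blindChoice (n : ℕ) [NeZero n] : StoppingTime n where
  time _ _ := 0
  adapted _ _ _ _ _ := rfl

/-- The threshold `t_n`: the smallest positive integer `t` with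
`1/t + 1/(t+1) + ⋯ + 1/(n-1) ≤ 1`. -/
noncomputable def threshold (n : ℕ) : ℕ :=
  sInf {t : ℕ | 1 ≤ t ∧ ∑ i ∈ Finset.Ico t n, (1 : ℝ) / (i : ℝ) ≤ 1}

/-- The candidate appearing at time `k` is the best one among those that appeared up to then. -/
def IsRecord {n : ℕ} (σ τ : CandOrder n) (k : Fin n) : Prop :=
  ∀ i : Fin n, i < k → rank σ (τ k) < rank σ (τ i)

/-- `k` is the first time, not before the (1-based) threshold time `t_n`, at which the current
candidate is the best one so far. -/
def StopsAt {n : ℕ} (σ τ : CandOrder n) (k : Fin n) : Prop :=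
  threshold n ≤ (k : ℕ) + 1 ∧ IsRecord σ τ k ∧
    ∀ i : Fin n, threshold n ≤ (i : ℕ) + 1 → i < k → ¬ IsRecord σ τ i

theorem StopsAt.unique {n : ℕ} {σ τ : CandOrder n} {k k' : Fin n}
    (h : StopsAt σ τ k) (h' : StopsAt σ τ k') : k = k' := by
  rcases lt_trichotomy k k' with hlt | heq | hgt
  · exact absurd h.2.1 (h'.2.2 k h.1 hlt)
  · exact heq
  · exact absurd h'.2.1 (h.2.2 k' h'.1 hgt)

theorem isRecord_congr {n : ℕ} {σ τ σ' τ' : CandOrder n} {t k : Fin n} (hk : k ≤ t)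
    (h : ∀ i j : Fin n, i ≤ t → j ≤ t →
      (rank σ (τ i) < rank σ (τ j) ↔ rank σ' (τ' i) < rank σ' (τ' j))) :
    IsRecord σ τ k ↔ IsRecord σ' τ' k := by
  refine forall_congr' fun i => imp_congr_right fun hi => ?_
  exact h k i hk (hi.le.trans hk)

theorem stopsAt_congr {n : ℕ} {σ τ σ' τ' : CandOrder n} {t k : Fin n} (hk : k ≤ t)
    (h : ∀ i j : Fin n, i ≤ t → j ≤ t →
      (rank σ (τ i) < rank σ (τ j) ↔ rank σ' (τ' i) < rank σ' (τ' j))) :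
    StopsAt σ τ k ↔ StopsAt σ' τ' k := by
  refine and_congr_right fun _ => and_congr (isRecord_congr hk h) ?_
  refine forall_congr' fun i => imp_congr_right fun _ => imp_congr_right fun hi => ?_
  exact not_congr (isRecord_congr (hi.le.trans hk) h)

open Classical in
/-- The time at which the optimal algorithm for the secretary problem stops: the time `k` with
`StopsAt σ τ k` if there is one, and the last time otherwise. -/
noncomputable def secretaryTime {n : ℕ} [NeZero n] (σ τ : CandOrder n) : Fin n :=
  if h : ∃ k : Fin n, StopsAt σ τ k then h.choose
  else ⟨n - 1, Nat.sub_lt (Nat.pos_of_ne_zero (NeZero.ne n)) Nat.one_pos⟩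

theorem secretaryTime_of_stopsAt {n : ℕ} [NeZero n] {σ τ : CandOrder n} {k : Fin n}
    (h : StopsAt σ τ k) : secretaryTime σ τ = k := by
  have hex : ∃ k : Fin n, StopsAt σ τ k := ⟨k, h⟩
  rw [secretaryTime, dif_pos hex]
  exact hex.choose_spec.unique h

theorem secretaryTime_of_not {n : ℕ} [NeZero n] {σ τ : CandOrder n}
    (h : ¬ ∃ k : Fin n, StopsAt σ τ k) :
    secretaryTime σ τ = ⟨n - 1, Nat.sub_lt (Nat.pos_of_ne_zero (NeZero.ne n)) Nat.one_pos⟩ := by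
  rw [secretaryTime, dif_neg h]

/-- The optimal algorithm `M*` for the secretary problem. -/
noncomputable def secretary (n : ℕ) [NeZero n] : StoppingTime n where
  time := secretaryTime
  adapted σ τ σ' τ' h := by
    by_cases hex : ∃ k : Fin n, StopsAt σ τ k
    · obtain ⟨k, hk⟩ := hex
      rw [secretaryTime_of_stopsAt hk] at h ⊢
      exact secretaryTime_of_stopsAt ((stopsAt_congr le_rfl h).1 hk)
    · rw [secretaryTime_of_not hex] at h ⊢
      refine secretaryTime_of_not ?_
      rintro ⟨k, hk⟩
      refine hex ⟨k, (stopsAt_congr ?_ h).2 hk⟩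
      exact Fin.le_def.2 (Nat.le_sub_one_of_lt k.2)

/-- A randomized stopping algorithm: for each qualification ordering and time ordering, the
distribution of the time at which the algorithm stops (over its internal randomness). -/
abbrev RandomizedAlgorithm (n : ℕ) : Type :=
  CandOrder n → CandOrder n → ProbabilityMeasure (Fin n)

/-- The `p`-mix on `M₁` and `M₂`: toss a coin that shows heads with probability `p`, independently
of the time ordering; play `M₁` on heads and `M₂` on tails. -/
noncomputable def pMix {n : ℕ} (p : unitInterval) (M₁ M₂ : StoppingTime n) :
    RandomizedAlgorithm n := fun σ τ =>
  ⟨bernoulliMeasure (M₁.time σ τ) (M₂.time σ τ) p, inferInstance⟩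

/-- The probability that the candidate selected by `A` lies in `S`, when the qualification ordering
is `σ` and the time ordering is uniformly random. -/
noncomputable def selectProb {n : ℕ} (A : RandomizedAlgorithm n) (σ : CandOrder n)
    (S : Set (Fin n)) : ℝ :=
  (∑ τ : CandOrder n, (A σ τ : Measure (Fin n)).real {t : Fin n | τ t ∈ S}) / (n.factorial : ℝ)

/-- `A` is an `(ε, δ)`-differentially private stopping time with respect to `d`. -/
def IsDP {n : ℕ} (d : CandOrder n → CandOrder n → ℕ) (ε δ : ℝ) (A : RandomizedAlgorithm n) : Prop :=
  ∀ S : Set (Fin n), ∀ σ ρ : CandOrder n, d σ ρ ≤ 1 →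
    selectProb A σ S ≤ Real.exp ε * selectProb A ρ S + δ

/-- `Reaches l ρ k σ`: `σ = π₁ ∘ ⋯ ∘ π_k ∘ ρ`, where each `π_i` is a transposition of two
candidates whose positions in `π_{i+1} ∘ ⋯ ∘ π_k ∘ ρ` are at most `l` apart. -/
inductive Reaches {n : ℕ} (l : ℕ) (ρ : CandOrder n) : ℕ → CandOrder n → Prop
  | refl : Reaches l ρ 0 ρ
  | step {k : ℕ} {σ : CandOrder n} {a b : Fin n} : Reaches l ρ k σ → a ≠ b →
      Nat.dist (rank σ a) (rank σ b) ≤ l → Reaches l ρ (k + 1) (Equiv.swap a b * σ)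

/-- The `l`-distance: the least number of transpositions, each of two candidates at most `l` apart
in the current ordering, that lead from `ρ` to `σ`. -/
noncomputable def lDist {n : ℕ} (l : ℕ) (σ ρ : CandOrder n) : ℕ :=
  sInf {k : ℕ | Reaches l ρ k σ}

/-- For `l ≥ 1` the set in the definition of `lDist` is never empty. -/
theorem exists_reaches {n l : ℕ} (hl : 1 ≤ l) (σ ρ : CandOrder n) : ∃ k, Reaches l ρ k σ := by
  cases n with
  | zero => exact ⟨0, by rw [Subsingleton.elim σ ρ]; exact .refl⟩
  | succ m =>
    suffices H : ∀ π : CandOrder (m + 1), ∀ ρ, (∃ k, Reaches l ρ k (ρ * π)) by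
      obtain ⟨k, hk⟩ := H (ρ⁻¹ * σ) ρ
      exact ⟨k, by simpa using hk⟩
    intro π ρ
    have hπ : π ∈ Submonoid.closure
        (Set.range fun i : Fin m => Equiv.swap i.castSucc i.succ) := by
      rw [Equiv.Perm.mclosure_swap_castSucc_succ]; trivial
    induction hπ using Submonoid.closure_induction_right with
    | one => exact ⟨0, by simpa using Reaches.refl⟩
    | mul_right x _ y hy ih =>
      obtain ⟨k, hk⟩ := ih
      obtain ⟨i, rfl⟩ := hy
      refine ⟨k + 1, ?_⟩
      have hne : (ρ * x) i.castSucc ≠ (ρ * x) i.succ := by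
        intro h
        exact absurd ((ρ * x).injective h) (Fin.castSucc_lt_succ).ne
      have hd : Nat.dist (rank (ρ * x) ((ρ * x) i.castSucc))
          (rank (ρ * x) ((ρ * x) i.succ)) ≤ l := by
        simp only [rank, Equiv.symm_apply_apply, Nat.dist, Fin.val_castSucc, Fin.val_succ]
        omega
      have := Reaches.step hk hne hd
      rw [Equiv.swap_apply_apply] at this
      simpa [mul_assoc] using this

/-- `q_{k,n}`: the probability that the `p`-mix on the optimal algorithm for the secretary problem
and the blind choice selects the `k`-th best candidate, for the qualification ordering `σ`. -/
noncomputable def qProb {n : ℕ} [NeZero n] (p : unitInterval) (σ : CandOrder n) (k : ℕ) : ℝ :=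
  selectProb (pMix p (secretary n) (blindChoice n)) σ {c : Fin n | rank σ c = k}

/-- `a_k = ∑_{s ≥ k} (1/s) (1 - 1/e)^s`. -/
noncomputable def aCoef (k : ℕ) : ℝ :=
  ∑' s : ℕ, 1 / ((k + s : ℕ) : ℝ) * (1 - 1 / Real.exp 1) ^ (k + s)

end SecretaryDP

open SecretaryDP Filter Topology

namespace SecretaryDP

open Finset MeasureTheory ProbabilityTheory

/-! Relabel candidates by quality, so that the time ordering becomes a uniform permutation, and let
`r = threshold n - 1` be the number of rejected candidates. The mix selects the `k`-th best with
probability `q k = p * (r / n) * G k + (1 - p) / n`, where `G = scaledProb n r`. Here `G 1` is the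
harmonic sum over `[r, n)`, and `G` falls at each step by `D k = dropCoef n r k`, except that the
first drop is reduced by `1 / (n - 1)`, the contribution of being forced to take the last candidate
(`card_secretary_eq`, `recordProb_sub_succ`).

Privacy: distinct orderings at distance at most 1 differ by swapping two ranks at most `l` apart,
which reduces the claim to `q i - exp ε * q j ≤ δ` for `j ≤ i + l` (`sum_swap_le`). Since `q` is
decreasing and log-convex, `R = q 1 / q (l + 1)` bounds every such ratio `q i / q j`. If `exp ε ≥ R`
the difference is at most 0; otherwise it is at most `q 1 - exp ε * q (l + 1)`.

The core is log-convexity of `G` (`scaledProb_logConvex`). Written in terms of drops it is `D k ^ 2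
≤ G k * (D k - D (k + 1))`, with a variant at `k = 1`. For `n ≥ 64` it follows by descending
induction on `k`; smaller `n` are settled by exact integer arithmetic.

Limits: `r / n → 1 / e`, `G 1 → 1` and `D k → (1 - 1/e)^k / k`. These limits sum to `-log (1/e) =
1`, so `G k` tends to the tail `aCoef k`. -/

/-! ### Counting permutations with constraints on an initial segment. -/

/-- In `decomposeFin`, a permutation sending 0 to `p` treats the other points through `x ↦ swap 0 p
x.succ`, which enumerates the values other than `p`. -/
theorem card_swap_zero_succ_mem {n : ℕ} (p : Fin (n + 1)) (S : Finset (Fin (n + 1))) :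
    #{x : Fin n | Equiv.swap 0 p x.succ ∈ S} = #(S.erase p) := by
  refine card_bij (fun x _ => Equiv.swap 0 p x.succ) ?_ ?_ ?_
  · intro x hx
    simp only [mem_filter, mem_univ, true_and] at hx
    refine mem_erase.2 ⟨fun h => ?_, hx⟩
    rw [← Equiv.eq_symm_apply, Equiv.symm_swap, Equiv.swap_apply_right] at h
    exact Fin.succ_ne_zero x h
  · intro x _ y _ h
    exact Fin.succ_injective _ ((Equiv.swap 0 p).injective h)
  · intro y hy
    obtain ⟨hyp, hyS⟩ := mem_erase.1 hy
    have h0 : Equiv.swap 0 p y ≠ 0 := by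
      intro h
      rw [← Equiv.eq_symm_apply, Equiv.symm_swap, Equiv.swap_apply_left] at h
      exact hyp h
    obtain ⟨x, hx⟩ := Fin.exists_succ_eq.2 h0
    exact ⟨x, by simp [hx, hyS], by simp [hx]⟩

/-- The number of permutations of `Fin n` that map the first `a` points into `S`. -/
theorem card_perm_prefix_mem (n : ℕ) : ∀ (S : Finset (Fin n)) (a : ℕ), a ≤ n →
    #{φ : Equiv.Perm (Fin n) | ∀ j : Fin n, (j : ℕ) < a → φ j ∈ S} =
      (#S).descFactorial a * (n - a).factorial := by
  induction n with
  | zero =>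
    intro S a ha
    obtain rfl : a = 0 := by omega
    simp
  | succ n ih =>
    intro S a ha
    cases a with
    | zero => simp [Fintype.card_perm]
    | succ a =>
      have key : ∀ p : Fin (n + 1),
          #{e : Equiv.Perm (Fin n) | ∀ j : Fin (n + 1), (j : ℕ) < a + 1 →
            Equiv.Perm.decomposeFin.symm (p, e) j ∈ S} =
          if p ∈ S then (#S - 1).descFactorial a * (n - a).factorial else 0 := by
        intro p
        split_ifs with hp
        · rw [← card_erase_of_mem hp, ← card_swap_zero_succ_mem, ← ih _ a (by omega)]
          congr 1
          ext e
          simp only [mem_filter, mem_univ, true_and, Fin.forall_fin_succ,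
            Equiv.Perm.decomposeFin_symm_apply_zero, Equiv.Perm.decomposeFin_symm_apply_succ,
            Fin.val_succ, add_lt_add_iff_right]
          simp [hp]
        · rw [card_eq_zero, filter_eq_empty_iff]
          intro e _ h
          exact hp (by simpa using h 0 (by simp))
      have hsum : #{φ : Equiv.Perm (Fin (n + 1)) | ∀ j : Fin (n + 1), (j : ℕ) < a + 1 → φ j ∈ S} =
          ∑ p : Fin (n + 1), #{e : Equiv.Perm (Fin n) | ∀ j : Fin (n + 1), (j : ℕ) < a + 1 →
            Equiv.Perm.decomposeFin.symm (p, e) j ∈ S} := by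
        simp only [card_filter]
        rw [← Fintype.sum_prod_type'
          (f := fun p e => if ∀ j : Fin (n + 1), (j : ℕ) < a + 1 →
            Equiv.Perm.decomposeFin.symm (p, e) j ∈ S then 1 else 0)]
        exact Fintype.sum_equiv Equiv.Perm.decomposeFin _ _ (by simp)
      rw [hsum, sum_congr rfl fun p _ => key p, ← sum_filter, sum_const, smul_eq_mul]
      simp only [filter_univ_mem, Nat.add_sub_add_right]
      rw [← mul_assoc]
      congr 1
      rcases Nat.eq_zero_or_pos (#S) with h | h
      · simp [h]
      · obtain ⟨m, hm⟩ := Nat.exists_eq_succ_of_ne_zero h.ne'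
        rw [hm, Nat.succ_descFactorial_succ, Nat.succ_sub_one]

/-- The number of permutations of `Fin n` that map `s` to `k` and the points below `s` into `S`. -/
theorem card_perm_apply_eq_prefix_mem {n : ℕ} (s k : Fin n) (S : Finset (Fin n)) (hk : k ∉ S) :
    #{φ : Equiv.Perm (Fin n) | φ s = k ∧ ∀ j : Fin n, j < s → φ j ∈ S} =
      (#S).descFactorial s * (n - 1 - s).factorial := by
  cases n with
  | zero => exact s.elim0
  | succ n =>
    have hS : #S = #{x : Fin n | Equiv.swap 0 k x.succ ∈ S} := by
      rw [card_swap_zero_succ_mem, erase_eq_of_notMem hk]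
    rw [hS, Nat.add_sub_cancel, ← card_perm_prefix_mem n _ s (by omega)]
    symm
    -- Composing with `swap 0 s` moves the prescribed value to the point 0 and carries the points
    -- below `s` to `1, …, s`.
    refine card_bij (fun e _ => Equiv.Perm.decomposeFin.symm (k, e) * Equiv.swap 0 s) ?_ ?_ ?_
    · intro e he
      simp only [mem_filter, mem_univ, true_and] at he ⊢
      refine ⟨by simp, fun j hj => ?_⟩
      rw [Equiv.Perm.mul_apply]
      have h0 : Equiv.swap 0 s j ≠ 0 := by
        intro h
        rw [← Equiv.eq_symm_apply, Equiv.symm_swap, Equiv.swap_apply_left] at h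
        exact hj.ne h
      have hle : Equiv.swap 0 s j ≤ s := by
        rw [Equiv.swap_apply_def]
        split_ifs
        · exact le_rfl
        · exact Fin.zero_le _
        · exact hj.le
      obtain ⟨x, hx⟩ := Fin.exists_succ_eq.2 h0
      rw [← hx, Equiv.Perm.decomposeFin_symm_apply_succ]
      rw [← hx, Fin.le_def, Fin.val_succ] at hle
      exact he x (by omega)
    · intro e _ e' _ h
      have := Equiv.Perm.decomposeFin.symm.injective (mul_right_cancel h)
      exact (Prod.mk.inj this).2
    · intro φ hφ
      simp only [mem_filter, mem_univ, true_and] at hφ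
      obtain ⟨⟨p, e⟩, he⟩ := Equiv.Perm.decomposeFin.symm.surjective (φ * Equiv.swap 0 s)
      have hp : p = k := by
        have := congrArg (fun f => f 0) he
        simpa [hφ.1] using this
      subst hp
      refine ⟨e, ?_, by rw [he, mul_assoc, Equiv.swap_mul_self, mul_one]⟩
      simp only [mem_filter, mem_univ, true_and]
      intro j hj
      rw [← Equiv.Perm.decomposeFin_symm_apply_succ, he, Equiv.Perm.mul_apply]
      refine hφ.2 _ ?_
      rw [Equiv.swap_apply_def, if_neg (Fin.succ_ne_zero j)]
      split_ifs with h
      · rw [Fin.lt_def]; simp only [Fin.val_zero]; omega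
      · rw [Fin.lt_def, Fin.val_succ]
        have : (s : ℕ) ≠ j + 1 := fun h' => h (Fin.ext (by simp [h']))
        omega

/-- As `card_perm_apply_eq_prefix_mem`, for the number of permutations that moreover attain their
minimum on the points below `s` at one of the first `r` points. -/
theorem card_perm_apply_eq_prefix_gt_argmin {n : ℕ} (s k : Fin n) (r : ℕ) (hrs : r ≤ s) :
    #{φ : Equiv.Perm (Fin n) | φ s = k ∧ (∀ j : Fin n, j < s → k < φ j) ∧
        ∃ i : Fin n, (i : ℕ) < r ∧ ∀ j : Fin n, j < s → φ i ≤ φ j} * s =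
      r * ((n - 1 - k).descFactorial s * (n - 1 - s).factorial) := by
  set N : Fin n → ℕ := fun i => #{φ : Equiv.Perm (Fin n) | φ s = k ∧
    (∀ j : Fin n, j < s → k < φ j) ∧ ∀ j : Fin n, j < s → φ i ≤ φ j} with hN
  -- Precomposition with a transposition of two points below `s`: the minimum is equally likely to
  -- sit at each of the `s` points.
  have hsym : ∀ i i' : Fin n, i < s → i' < s → N i = N i' := by
    have aux : ∀ i i' : Fin n, i < s → i' < s → ∀ j : Fin n, j < s → Equiv.swap i i' j < s := by
      intro i i' hi hi' j hj
      rw [Equiv.swap_apply_def]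
      split_ifs <;> assumption
    intro i i' hi hi'
    refine card_bij (fun φ _ => φ * Equiv.swap i i') ?_ ?_ ?_
    · intro φ hφ
      simp only [mem_filter, mem_univ, true_and, Equiv.Perm.mul_apply] at hφ ⊢
      refine ⟨?_, fun j hj => hφ.2.1 _ (aux i i' hi hi' j hj), fun j hj => ?_⟩
      · rw [Equiv.swap_apply_of_ne_of_ne hi.ne' hi'.ne', hφ.1]
      · rw [Equiv.swap_apply_right]
        exact hφ.2.2 _ (aux i i' hi hi' j hj)
    · intro φ _ ψ _ h
      exact mul_right_cancel h
    · intro φ hφ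
      simp only [mem_filter, mem_univ, true_and] at hφ
      refine ⟨φ * Equiv.swap i i', ?_, by rw [mul_assoc, Equiv.swap_mul_self, mul_one]⟩
      simp only [mem_filter, mem_univ, true_and, Equiv.Perm.mul_apply]
      refine ⟨?_, fun j hj => hφ.2.1 _ (aux i i' hi hi' j hj), fun j hj => ?_⟩
      · rw [Equiv.swap_apply_of_ne_of_ne hi.ne' hi'.ne', hφ.1]
      · rw [Equiv.swap_apply_left]
        exact hφ.2.2 _ (aux i i' hi hi' j hj)
  have hcount : ∀ m : ℕ, m ≤ s →
      #{φ : Equiv.Perm (Fin n) | φ s = k ∧ (∀ j : Fin n, j < s → k < φ j) ∧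
        ∃ i : Fin n, (i : ℕ) < m ∧ ∀ j : Fin n, j < s → φ i ≤ φ j} =
      ∑ i ∈ ({i : Fin n | (i : ℕ) < m} : Finset (Fin n)), N i := by
    intro m hm
    rw [hN, ← card_biUnion]
    · congr 1
      ext φ
      simp only [mem_filter, mem_univ, true_and, mem_biUnion]
      exact ⟨fun ⟨h₁, h₂, i, hi, h₃⟩ => ⟨i, hi, h₁, h₂, h₃⟩,
        fun ⟨i, hi, h₁, h₂, h₃⟩ => ⟨h₁, h₂, i, hi, h₃⟩⟩
    · intro i hi i' hi' hne
      simp only [coe_filter, mem_univ, true_and, Set.mem_ofPred_eq] at hi hi'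
      refine disjoint_left.2 fun φ h h' => hne ?_
      simp only [mem_filter, mem_univ, true_and] at h h'
      exact φ.injective (le_antisymm (h.2.2 i' (Fin.lt_def.2 (by omega)))
        (h'.2.2 i (Fin.lt_def.2 (by omega))))
  have hcardlt : ∀ m : ℕ, m ≤ n → #{i : Fin n | (i : ℕ) < m} = m := by
    intro m hm
    rw [Fin.card_filter_val_lt, min_eq_right hm]
  rcases Nat.eq_zero_or_pos r with rfl | hr
  · simp
  set i₀ : Fin n := ⟨0, by omega⟩
  have hconst : ∀ m : ℕ, m ≤ s →
      ∑ i ∈ ({i : Fin n | (i : ℕ) < m} : Finset (Fin n)), N i = m * N i₀ := by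
    intro m hm
    rw [sum_congr rfl (g := fun _ => N i₀), sum_const, hcardlt m (by omega), smul_eq_mul]
    intro i hi
    simp only [mem_filter, mem_univ, true_and] at hi
    exact hsym _ _ (Fin.lt_def.2 (by omega)) (Fin.lt_def.2 (by simp [i₀]; omega))
  -- With `s` in place of `r` the condition on the minimum is void; comparing the two counts gives
  -- the factor `r / s`.
  have hall : #{φ : Equiv.Perm (Fin n) | φ s = k ∧ (∀ j : Fin n, j < s → k < φ j) ∧
        ∃ i : Fin n, (i : ℕ) < s ∧ ∀ j : Fin n, j < s → φ i ≤ φ j} =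
      (n - 1 - k).descFactorial s * (n - 1 - s).factorial := by
    have := card_perm_apply_eq_prefix_mem s k (Ioi k) (by simp)
    rw [Fin.card_Ioi] at this
    rw [← this]
    congr 1
    ext φ
    simp only [mem_filter, mem_univ, true_and, mem_Ioi]
    refine and_congr_right fun _ => and_iff_left ?_
    obtain ⟨i, hi, hmin⟩ := exists_min_image (Iio s) φ
      ⟨i₀, mem_Iio.2 (Fin.lt_def.2 (by simp [i₀]; omega))⟩
    exact ⟨i, Fin.lt_def.1 (mem_Iio.1 hi), fun j hj => hmin j (mem_Iio.2 hj)⟩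
  rw [← hall, hcount r hrs, hcount s le_rfl, hconst r hrs, hconst s le_rfl]
  ring

theorem card_perm_two_values {n : ℕ} {a b x y : Fin n} (hab : a ≠ b) (hxy : x ≠ y) :
    #{φ : Equiv.Perm (Fin n) | φ a = x ∧ φ b = y} = (n - 2).factorial := by
  have h2 : 2 ≤ n := by
    have := Fintype.one_lt_card_iff.2 ⟨a, b, hab⟩
    rwa [Fintype.card_fin] at this
  set z : Fin n := ⟨0, by omega⟩
  set o : Fin n := ⟨1, by omega⟩
  have hzo : z ≠ o := by simp [z, o, Fin.ext_iff]
  have h := card_perm_apply_eq_prefix_mem o y {x} (by simpa using hxy.symm)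
  simp only [card_singleton, o, Nat.descFactorial_one, one_mul] at h
  rw [show n - 2 = n - 1 - 1 by omega, ← h]
  obtain ⟨ψ, hψa, hψb⟩ : ∃ ψ : Equiv.Perm (Fin n), ψ z = a ∧ ψ o = b := by
    refine ⟨Equiv.swap (Equiv.swap z a o) b * Equiv.swap z a, ?_, by simp⟩
    rw [Equiv.Perm.mul_apply, Equiv.swap_apply_left, Equiv.swap_apply_of_ne_of_ne _ hab]
    intro h
    rw [← Equiv.symm_apply_eq, Equiv.symm_swap, Equiv.swap_apply_right] at h
    exact hzo h
  have hlt : ∀ j : Fin n, j < o ↔ j = z := by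
    intro j
    simp only [Fin.lt_def, Fin.ext_iff, z, o]
    omega
  refine card_bij (fun φ _ => φ * ψ) ?_ ?_ ?_
  · intro φ hφ
    simp only [mem_filter, mem_univ, true_and, Equiv.Perm.mul_apply, mem_singleton] at hφ ⊢
    refine ⟨by rw [hψb, hφ.2], fun j hj => ?_⟩
    rw [(hlt j).1 hj, hψa, hφ.1]
  · intro φ _ φ' _ h
    exact mul_right_cancel h
  · intro φ hφ
    simp only [mem_filter, mem_univ, true_and, mem_singleton] at hφ
    refine ⟨φ * ψ⁻¹, ?_, by simp⟩
    simp only [mem_filter, mem_univ, true_and, Equiv.Perm.mul_apply]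
    rw [← hψa, ← hψb, Equiv.Perm.inv_def, Equiv.symm_apply_apply, Equiv.symm_apply_apply]
    exact ⟨hφ.2 z ((hlt z).2 rfl), hφ.1⟩

/-! ### The law of the selected candidate. -/

theorem selectProb_pMix {n : ℕ} (p : unitInterval) (M₁ M₂ : StoppingTime n) (σ : CandOrder n)
    (S : Set (Fin n)) [DecidablePred (· ∈ S)] :
    selectProb (pMix p M₁ M₂) σ S = ∑ c : Fin n with c ∈ S,
      ((p : ℝ) * (#{τ : CandOrder n | τ (M₁.time σ τ) = c} / n.factorial) +
        (1 - p) * (#{τ : CandOrder n | τ (M₂.time σ τ) = c} / n.factorial)) := by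
  have hfib : ∀ M : StoppingTime n,
      ∑ τ : CandOrder n, (if τ (M.time σ τ) ∈ S then (1 : ℝ) else 0) =
      ∑ c : Fin n with c ∈ S, (#{τ : CandOrder n | τ (M.time σ τ) = c} : ℝ) := by
    intro M
    simp_rw [card_filter, Nat.cast_sum]
    rw [sum_comm]
    refine sum_congr rfl fun τ _ => ?_
    simp [sum_ite_eq]
  have hmeas : ∀ τ : CandOrder n,
      ((pMix p M₁ M₂ σ τ : ProbabilityMeasure (Fin n)) : Measure (Fin n)).real {t | τ t ∈ S} =
      p * (if τ (M₁.time σ τ) ∈ S then (1 : ℝ) else 0) +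
        (1 - p) * (if τ (M₂.time σ τ) ∈ S then (1 : ℝ) else 0) := by
    intro τ
    classical
    simp only [pMix, ProbabilityMeasure.coe_mk]
    rw [bernoulliMeasure_real_apply p (MeasurableSet.of_discrete)]
    by_cases h₁ : τ (M₁.time σ τ) ∈ S <;> by_cases h₂ : τ (M₂.time σ τ) ∈ S <;> simp [h₁, h₂]
  rw [selectProb, sum_congr rfl fun τ _ => hmeas τ, sum_add_distrib, ← mul_sum, ← mul_sum, hfib,
    hfib, sum_add_distrib, ← mul_sum, ← mul_sum, ← sum_div, ← sum_div]
  ring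

theorem isRecord_mul_iff {n : ℕ} (σ π : CandOrder n) (k : Fin n) :
    IsRecord σ (σ * π) k ↔ ∀ i : Fin n, i < k → π k < π i := by
  simp [IsRecord, rank]

/-- No admissible record precedes `s` exactly when the best candidate seen before `s` is among the
`r` rejected ones: otherwise that candidate was itself an admissible record. -/
theorem stopsAt_mul_iff {n r : ℕ} (hr : threshold n = r + 1) (hr0 : 1 ≤ r) (σ π : CandOrder n)
    (s : Fin n) :
    StopsAt σ (σ * π) s ↔ r ≤ (s : ℕ) ∧ (∀ j : Fin n, j < s → π s < π j) ∧
      ∃ i : Fin n, (i : ℕ) < r ∧ ∀ j : Fin n, j < s → π i ≤ π j := by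
  simp only [StopsAt, isRecord_mul_iff, hr, Nat.add_le_add_iff_right]
  refine and_congr_right fun hs => and_congr_right fun _ => ⟨fun h => ?_, ?_⟩
  · obtain ⟨i, hi, hmin⟩ := exists_min_image (Iio s) π
      ⟨⟨0, by omega⟩, mem_Iio.2 (Fin.lt_def.2 (by simp; omega))⟩
    refine ⟨i, ?_, fun j hj => hmin j (mem_Iio.2 hj)⟩
    by_contra! hir
    refine h i hir (mem_Iio.1 hi) fun j hj => ?_
    refine lt_of_le_of_ne (hmin j (mem_Iio.2 (hj.trans (mem_Iio.1 hi)))) fun h' => ?_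
    exact hj.ne' (π.injective h')
  · rintro ⟨i, hi, hmin⟩ j hj hjs hrec
    exact absurd (hmin j hjs) (not_le.2 (hrec i (Fin.lt_def.2 (by omega))))

theorem not_exists_stopsAt_mul_iff {n r : ℕ} [NeZero n] (hr : threshold n = r + 1)
    (σ π : CandOrder n) :
    (¬ ∃ s, StopsAt σ (σ * π) s) ↔ ∃ i : Fin n, (i : ℕ) < r ∧ π i = 0 := by
  simp only [StopsAt, isRecord_mul_iff, hr, Nat.add_le_add_iff_right]
  constructor
  · intro h
    by_contra! h'
    apply h
    -- If the best candidate is not rejected, its appearance is an admissible record, so a first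
    -- such record exists.
    obtain ⟨s, hs, hmin⟩ := exists_min_image
      {s : Fin n | r ≤ (s : ℕ) ∧ ∀ i : Fin n, i < s → π s < π i} id ⟨π.symm 0, by
        simp only [mem_filter, mem_univ, true_and, Equiv.apply_symm_apply]
        refine ⟨not_lt.1 fun hlt => h' _ hlt (by simp), fun i hi => Fin.pos_iff_ne_zero.2 ?_⟩
        rintro h0
        rw [← h0, Equiv.symm_apply_apply] at hi
        exact hi.false⟩
    simp only [mem_filter, mem_univ, true_and, id] at hs hmin
    exact ⟨s, hs.1, hs.2, fun i hi his hrec => absurd (hmin i ⟨hi, hrec⟩) (not_le.2 his)⟩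
  · rintro ⟨i, hi, hi0⟩ ⟨s, hs, hrec, -⟩
    have := hrec i (Fin.lt_def.2 (by omega))
    rw [hi0] at this
    exact absurd this (Fin.not_lt_zero _)

/-- The probability that the `(k + 1)`-st best of `n` candidates is chosen at a record time, if the
first `r` candidates are rejected. -/
noncomputable def recordProb (n r k : ℕ) : ℝ :=
  ∑ s ∈ Ico r n, (r : ℝ) / (n * s) * ((n - 1 - s).choose k / (n - 1).choose k)

/-- Both sides equal `N! / (k! s! (N - k - s)!)` if `k + s ≤ N`, and vanish otherwise. The exchange
produces binomials with fixed lower index `k`, which can be summed over `s`. -/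
theorem choose_sub_mul_choose_comm (N k s : ℕ) :
    (N - k).choose s * N.choose k = (N - s).choose k * N.choose s := by
  rcases le_or_gt (k + s) N with h | h
  · obtain ⟨m, rfl⟩ := Nat.exists_eq_add_of_le h
    rw [show k + s + m - k = s + m by omega, show k + s + m - s = k + m by omega]
    have h₁ := Nat.choose_mul_factorial_mul_factorial (show s ≤ s + m by omega)
    have h₂ := Nat.choose_mul_factorial_mul_factorial (show k ≤ k + s + m by omega)
    have h₃ := Nat.choose_mul_factorial_mul_factorial (show k ≤ k + m by omega)
    have h₄ := Nat.choose_mul_factorial_mul_factorial (show s ≤ k + s + m by omega)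
    rw [show s + m - s = m by omega] at h₁
    rw [show k + s + m - k = s + m by omega] at h₂
    rw [show k + m - k = m by omega] at h₃
    rw [show k + s + m - s = k + m by omega] at h₄
    have hpos : 0 < k.factorial * s.factorial * m.factorial := by positivity
    refine Nat.eq_of_mul_eq_mul_right hpos ?_
    calc _ = (k + s + m).choose k * k.factorial *
          ((s + m).choose s * s.factorial * m.factorial) := by ring
      _ = (k + s + m).choose s * s.factorial *
          ((k + m).choose k * k.factorial * m.factorial) := by rw [h₁, h₂, h₃, h₄]
      _ = _ := by ring
  · have hz : ∀ a b : ℕ, N < a + b → (N - a).choose b * N.choose a = 0 := by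
      intro a b hab
      rcases le_or_gt a N with ha | ha
      · rw [Nat.choose_eq_zero_of_lt (show N - a < b by omega), zero_mul]
      · rw [Nat.choose_eq_zero_of_lt ha, mul_zero]
    rw [hz k s h, hz s k (by omega)]

theorem card_stop_at_record {n r : ℕ} (hr0 : 1 ≤ r) (s k : Fin n) (hrs : r ≤ (s : ℕ)) :
    (#{φ : Equiv.Perm (Fin n) | φ s = k ∧ (∀ j : Fin n, j < s → k < φ j) ∧
        ∃ i : Fin n, (i : ℕ) < r ∧ ∀ j : Fin n, j < s → φ i ≤ φ j} : ℝ) / n.factorial =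
      (r : ℝ) / (n * s) * ((n - 1 - s).choose k / (n - 1).choose k) := by
  have h := card_perm_apply_eq_prefix_gt_argmin s k r hrs
  generalize #{φ : Equiv.Perm (Fin n) | φ s = k ∧ (∀ j : Fin n, j < s → k < φ j) ∧
        ∃ i : Fin n, (i : ℕ) < r ∧ ∀ j : Fin n, j < s → φ i ≤ φ j} = A at h ⊢
  obtain ⟨N, rfl⟩ : ∃ N, n = N + 1 := ⟨n - 1, by omega⟩
  have hs := s.isLt
  have hk := k.isLt
  generalize (s : ℕ) = s at *
  generalize (k : ℕ) = k at *
  rw [Nat.add_sub_cancel] at h ⊢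
  have h1 := choose_sub_mul_choose_comm N k s
  have h2 := Nat.choose_mul_factorial_mul_factorial (show s ≤ N by omega)
  rw [Nat.descFactorial_eq_factorial_mul_choose] at h
  have hc1 : (0 : ℝ) < N.choose k := by exact_mod_cast Nat.choose_pos (by omega)
  have hc2 : (0 : ℝ) < N.choose s := by exact_mod_cast Nat.choose_pos (by omega)
  have hs0 : (0 : ℝ) < s := by exact_mod_cast (by omega : 0 < s)
  have hf1 : (0 : ℝ) < s.factorial := by exact_mod_cast s.factorial_pos
  have hf2 : (0 : ℝ) < (N - s).factorial := by exact_mod_cast (N - s).factorial_pos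
  rw [Nat.factorial_succ, ← h2]
  have h' : (A : ℝ) * s = r * (s.factorial * (N - k).choose s * (N - s).factorial) := by
    exact_mod_cast h
  have h1' : ((N - k).choose s : ℝ) * N.choose k = (N - s).choose k * N.choose s := by
    exact_mod_cast h1
  push_cast
  rw [div_mul_div_comm, div_eq_div_iff (by positivity) (by positivity)]
  linear_combination ((N : ℝ) + 1) * N.choose k * h' +
    ((N : ℝ) + 1) * r * s.factorial * (N - s).factorial * h1'

theorem card_first_values_of_last {n r : ℕ} [NeZero n] (hrn : r < n) (k m : Fin n)
    (hm : (m : ℕ) = n - 1) :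
    #{π : CandOrder n | (∃ i : Fin n, (i : ℕ) < r ∧ π i = 0) ∧ π m = k} =
      if (k : ℕ) = 0 then 0 else r * (n - 2).factorial := by
  split_ifs with hk
  · rw [card_eq_zero, filter_eq_empty_iff]
    rintro π - ⟨⟨i, hi, hi0⟩, hmk⟩
    have : i = m := π.injective (by rw [hi0, hmk]; exact Fin.ext (by simp [hk]))
    subst this
    omega
  · have hk0 : (0 : Fin n) ≠ k := fun h => hk (by simp [← h])
    have : ({π : CandOrder n | (∃ i : Fin n, (i : ℕ) < r ∧ π i = 0) ∧ π m = k} :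
        Finset (CandOrder n)) = ({i : Fin n | (i : ℕ) < r} : Finset (Fin n)).biUnion
          fun i => ({π : CandOrder n | π i = 0 ∧ π m = k} : Finset (CandOrder n)) := by
      ext π
      simp only [mem_filter, mem_univ, true_and, mem_biUnion]
      exact ⟨fun ⟨⟨i, hi, h₁⟩, h₂⟩ => ⟨i, hi, h₁, h₂⟩, fun ⟨i, hi, h₁, h₂⟩ => ⟨⟨i, hi, h₁⟩, h₂⟩⟩
    rw [this, card_biUnion, sum_congr rfl (g := fun _ => (n - 2).factorial), sum_const,
      Fin.card_filter_val_lt, min_eq_right hrn.le, smul_eq_mul]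
    · intro i hi
      simp only [mem_filter, mem_univ, true_and] at hi
      refine card_perm_two_values (fun h => ?_) hk0
      rw [h] at hi
      omega
    · intro i _ i' _ hne
      refine disjoint_left.2 fun φ h h' => hne ?_
      simp only [mem_filter, mem_univ, true_and] at h h'
      exact φ.injective (h.1.trans h'.1.symm)

/-- Either the algorithm stops at a record, or the best candidate was rejected and the last one is
taken. The second event has probability `r (n - 2)! / n!` for each candidate other than the best. -/
theorem card_secretary_eq {n r : ℕ} [NeZero n] (hr : threshold n = r + 1) (hr0 : 1 ≤ r)
    (hrn : r < n) (σ : CandOrder n) (c : Fin n) :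
    (#{τ : CandOrder n | τ ((secretary n).time σ τ) = c} : ℝ) / n.factorial =
      recordProb n r (σ.symm c) + if (σ.symm c : ℕ) = 0 then 0 else (r : ℝ) / (n * (n - 1)) := by
  classical
  set k := σ.symm c with hk
  set m : Fin n := ⟨n - 1, by omega⟩ with hm
  have h₁ : #{τ : CandOrder n | τ ((secretary n).time σ τ) = c} =
      #{π : CandOrder n | π (secretaryTime σ (σ * π)) = k} := by
    symm
    refine card_bij (fun π _ => σ * π) ?_ (fun _ _ _ _ h => mul_left_cancel h) ?_
    · intro π hπ
      simp only [mem_filter, mem_univ, true_and] at hπ ⊢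
      change σ (π (secretaryTime σ (σ * π))) = c
      rw [hπ, hk, Equiv.apply_symm_apply]
    · intro τ hτ
      simp only [mem_filter, mem_univ, true_and] at hτ
      refine ⟨σ⁻¹ * τ, ?_, by simp⟩
      simp only [mem_filter, mem_univ, true_and, mul_inv_cancel_left]
      rw [hk, ← hτ]
      rfl
  set F : Fin n → Finset (CandOrder n) := fun s => {φ : CandOrder n | φ s = k ∧
    (∀ j : Fin n, j < s → k < φ j) ∧ ∃ i : Fin n, (i : ℕ) < r ∧ ∀ j : Fin n, j < s → φ i ≤ φ j}
  set E : Finset (CandOrder n) :=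
    {π : CandOrder n | (∃ i : Fin n, (i : ℕ) < r ∧ π i = 0) ∧ π m = k}
  set R : Finset (Fin n) := {s : Fin n | r ≤ (s : ℕ)}
  have hF : ∀ s ∈ R, ∀ φ : CandOrder n, φ ∈ F s ↔ StopsAt σ (σ * φ) s ∧ φ s = k := by
    intro s hs φ
    simp only [R, F, mem_filter, mem_univ, true_and] at hs ⊢
    rw [stopsAt_mul_iff hr hr0]
    constructor
    · rintro ⟨hφ, h⟩
      rw [hφ]
      exact ⟨⟨hs, h⟩, rfl⟩
    · rintro ⟨⟨_, h⟩, hφ⟩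
      rw [hφ] at h
      exact ⟨hφ, h⟩
  have h₂ : ({π : CandOrder n | π (secretaryTime σ (σ * π)) = k} : Finset (CandOrder n)) =
      R.biUnion F ∪ E := by
    ext π
    simp only [mem_union, mem_biUnion]
    by_cases h : ∃ s, StopsAt σ (σ * π) s
    · have hE : π ∉ E := fun hE => by
        simp only [E, mem_filter, mem_univ, true_and] at hE
        exact (not_exists_stopsAt_mul_iff hr σ π).2 hE.1 h
      obtain ⟨s, hs⟩ := h
      have hsR : s ∈ R := by
        simp only [R, mem_filter, mem_univ, true_and]
        exact ((stopsAt_mul_iff hr hr0 σ π s).1 hs).1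
      simp only [mem_filter, mem_univ, true_and, secretaryTime_of_stopsAt hs, hE, or_false]
      constructor
      · intro h
        exact ⟨s, hsR, (hF s hsR π).2 ⟨hs, h⟩⟩
      · rintro ⟨s', hs'R, hs'⟩
        obtain ⟨h, h'⟩ := (hF s' hs'R π).1 hs'
        rwa [hs.unique h]
    · have h' := (not_exists_stopsAt_mul_iff hr σ π).1 h
      simp only [mem_filter, mem_univ, true_and, secretaryTime_of_not h, E]
      constructor
      · intro h''
        exact Or.inr ⟨h', h''⟩
      · rintro (⟨s, hsR, hs⟩ | h'')
        · exact absurd ⟨s, ((hF s hsR π).1 hs).1⟩ h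
        · exact h''.2
  have hdisj : Disjoint (R.biUnion F) E := by
    refine disjoint_left.2 fun π h hE => ?_
    obtain ⟨s, hsR, hs⟩ := mem_biUnion.1 h
    simp only [E, mem_filter, mem_univ, true_and] at hE
    exact (not_exists_stopsAt_mul_iff hr σ π).2 hE.1 ⟨s, ((hF s hsR π).1 hs).1⟩
  rw [h₁, h₂, card_union_of_disjoint hdisj, card_biUnion, card_first_values_of_last hrn k m rfl]
  · push_cast
    rw [add_div, sum_div]
    congr 1
    · rw [sum_congr rfl fun s hs => card_stop_at_record hr0 s k (by simpa [R] using hs), recordProb]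
      rw [← sum_image (s := R) (g := fun s : Fin n => (s : ℕ))
        (f := fun s : ℕ => (r : ℝ) / (n * s) * ((n - 1 - s).choose k / (n - 1).choose k))
        (fun _ _ _ _ h => Fin.ext h)]
      congr 1
      ext s
      simp only [R, mem_image, mem_filter, mem_univ, true_and, mem_Ico]
      exact ⟨fun ⟨a, ha, h⟩ => ⟨by omega, by omega⟩, fun ⟨ha, hb⟩ => ⟨⟨s, hb⟩, ha, rfl⟩⟩
    · split_ifs
      · simp
      · obtain ⟨N, rfl⟩ : ∃ N, n = N + 2 := ⟨n - 2, by omega⟩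
        have : (0 : ℝ) < N.factorial := by exact_mod_cast N.factorial_pos
        simp only [Nat.add_sub_cancel, Nat.factorial_succ]
        push_cast
        rw [show (N : ℝ) + 2 - 1 = N + 1 by ring]
        field_simp
        ring
  · intro s hs s' hs' hne
    refine disjoint_left.2 fun φ h h' => hne ?_
    exact ((hF s hs φ).1 h).1.unique ((hF s' hs' φ).1 h').1

theorem card_blindChoice_eq {n : ℕ} [NeZero n] (σ : CandOrder n) (c : Fin n) :
    (#{τ : CandOrder n | τ ((blindChoice n).time σ τ) = c} : ℝ) / n.factorial = 1 / n := by
  have h : #{τ : CandOrder n | τ ((blindChoice n).time σ τ) = c} = (n - 1).factorial := by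
    have h := card_perm_apply_eq_prefix_mem (0 : Fin n) c ∅ (by simp)
    simp only [Fin.not_lt_zero, false_implies, implies_true, and_true, card_empty, Fin.val_zero,
      Nat.descFactorial_zero, one_mul, Nat.sub_zero] at h
    exact h
  obtain ⟨N, rfl⟩ : ∃ N, n = N + 1 := ⟨n - 1, by have := NeZero.pos n; omega⟩
  rw [h, Nat.add_sub_cancel, Nat.factorial_succ]
  have : (0 : ℝ) < N.factorial := by exact_mod_cast N.factorial_pos
  push_cast
  field_simp

/-! ### Differences between successive ranks. -/

theorem recordProb_nonneg (n r k : ℕ) : 0 ≤ recordProb n r k :=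
  sum_nonneg fun _ _ => by positivity

theorem recordProb_zero (n r : ℕ) :
    recordProb n r 0 = (r : ℝ) / n * ∑ s ∈ Ico r n, (1 : ℝ) / s := by
  rw [recordProb, mul_sum]
  refine sum_congr rfl fun s _ => ?_
  simp [div_eq_mul_inv]
  ring

theorem sum_range_choose_right (M k : ℕ) : ∑ j ∈ range M, j.choose k = M.choose (k + 1) := by
  induction M with
  | zero => simp
  | succ M ih => rw [sum_range_succ, ih, Nat.choose_succ_succ, add_comm]

theorem sum_Ico_choose_sub (n r k : ℕ) :
    ∑ s ∈ Ico r n, (n - 1 - s).choose k = (n - r).choose (k + 1) := by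
  rw [sum_Ico_eq_sum_range, ← sum_range_choose_right,
    ← sum_range_reflect (fun j => j.choose k)]
  refine sum_congr rfl fun i hi => ?_
  congr 1
  omega

theorem cast_choose_succ_mul (N k : ℕ) :
    (N.choose (k + 1) : ℝ) * (k + 1) = N.choose k * ((N : ℝ) - k) := by
  rcases le_or_gt k N with h | h
  · have := Nat.choose_succ_right_eq N k
    rw [← Nat.cast_sub h]
    exact_mod_cast this
  · simp [Nat.choose_eq_zero_of_lt h, Nat.choose_eq_zero_of_lt (h.trans (Nat.lt_succ_self k))]

/-- The decrement, up to the factor `r / n`, of `recordProb n r` from `k - 1` to `k`. -/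
noncomputable def dropCoef (n r k : ℕ) : ℝ := ((n - r).choose k : ℝ) / (k * (n - 1).choose k)

theorem dropCoef_nonneg (n r k : ℕ) : 0 ≤ dropCoef n r k := by
  rw [dropCoef]; positivity

theorem dropCoef_eq_zero {n r k : ℕ} (h : n - r < k) : dropCoef n r k = 0 := by
  rw [dropCoef, Nat.choose_eq_zero_of_lt h]; simp

theorem dropCoef_pos {n r k : ℕ} (hr : 1 ≤ r) (hk : 1 ≤ k) (h : k ≤ n - r) :
    0 < dropCoef n r k := by
  have h₁ : (0 : ℝ) < (n - r).choose k := by exact_mod_cast Nat.choose_pos h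
  have h₂ : (0 : ℝ) < (n - 1).choose k := by exact_mod_cast Nat.choose_pos (by omega)
  have h₃ : (0 : ℝ) < k := by exact_mod_cast hk
  rw [dropCoef]; positivity

theorem dropCoef_one {n r : ℕ} (hrn : r ≤ n) (hn : 1 ≤ n) :
    dropCoef n r 1 = ((n : ℝ) - r) / (n - 1) := by
  simp [dropCoef, Nat.cast_sub hrn, Nat.cast_sub hn]

theorem dropCoef_succ {n r k : ℕ} (hrn : r ≤ n) (hk : 1 ≤ k) (hkn : k + 1 < n) :
    ((k : ℝ) + 1) * ((n : ℝ) - 1 - k) * dropCoef n r (k + 1) =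
      k * ((n : ℝ) - r - k) * dropCoef n r k := by
  have h₁ := cast_choose_succ_mul (n - r) k
  have h₂ := cast_choose_succ_mul (n - 1) k
  rw [Nat.cast_sub hrn] at h₁
  rw [Nat.cast_sub (by omega : 1 ≤ n), Nat.cast_one] at h₂
  have h₃ : (0 : ℝ) < (n - 1).choose k := by exact_mod_cast Nat.choose_pos (by omega)
  have h₄ : (0 : ℝ) < (n - 1).choose (k + 1) := by exact_mod_cast Nat.choose_pos (by omega)
  have h₅ : (0 : ℝ) < k := by exact_mod_cast hk
  have h₆ : (0 : ℝ) < (k : ℝ) + 1 := by positivity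
  rw [dropCoef, dropCoef]
  push_cast
  rw [mul_div_assoc', mul_div_assoc', div_eq_div_iff (by positivity) (by positivity)]
  linear_combination (k * ((n : ℝ) - 1 - k) * (n - 1).choose k) * h₁ -
    k * ((n : ℝ) - r - k) * ((n - r).choose k) * h₂

/-- The difference of the two binomial ratios carries a factor `s`, which cancels the `1 / s` of the
summand; what remains is a hockey-stick sum. -/
theorem recordProb_sub_succ {n r k : ℕ} (hr : 1 ≤ r) (hk : k + 1 < n) :
    recordProb n r k - recordProb n r (k + 1) = (r : ℝ) / n * dropCoef n r (k + 1) := by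
  have hn : (0 : ℝ) < n := by exact_mod_cast (by omega : 0 < n)
  rw [dropCoef, ← sum_Ico_choose_sub, Nat.cast_sum, sum_div, mul_sum, recordProb, recordProb,
    ← sum_sub_distrib]
  refine sum_congr rfl fun s hs => ?_
  obtain ⟨hrs, hsn⟩ := mem_Ico.1 hs
  have h₁ := cast_choose_succ_mul (n - 1) k
  have h₂ := cast_choose_succ_mul (n - 1 - s) k
  rw [Nat.cast_sub (by omega : s ≤ n - 1)] at h₂
  rw [Nat.cast_sub (by omega : 1 ≤ n), Nat.cast_one] at h₁ h₂
  have h₃ : (0 : ℝ) < (n - 1).choose k := by exact_mod_cast Nat.choose_pos (by omega)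
  have h₄ : (0 : ℝ) < (n - 1).choose (k + 1) := by exact_mod_cast Nat.choose_pos (by omega)
  have hs0 : (0 : ℝ) < s := by exact_mod_cast (by omega : 0 < s)
  have h₆ : (0 : ℝ) < (k : ℝ) + 1 := by positivity
  push_cast
  rw [← mul_sub, div_mul_eq_mul_div, div_mul_eq_mul_div, div_eq_div_iff (by positivity) hn.ne']
  have key : ((n - 1 - s).choose k / (n - 1).choose k - (n - 1 - s).choose (k + 1) /
      (n - 1).choose (k + 1) : ℝ) =
      s * ((n - 1 - s).choose k / (((k : ℝ) + 1) * (n - 1).choose (k + 1))) := by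
    rw [div_sub_div _ _ h₃.ne' h₄.ne', mul_div_assoc',
      div_eq_div_iff (by positivity) (by positivity)]
    linear_combination ((n - 1 - s).choose k : ℝ) * (n - 1).choose (k + 1) * h₁ -
      (n - 1).choose k * (n - 1).choose (k + 1) * h₂
  rw [key]
  ring

/-! ### Location of the threshold. -/

theorem log_le_sum_Ico {a n : ℕ} (ha : 1 ≤ a) (han : a ≤ n) :
    Real.log (n / a) ≤ ∑ i ∈ Ico a n, (1 : ℝ) / i := by
  induction n, han using Nat.le_induction with
  | base =>
    have : (a : ℝ) ≠ 0 := by positivity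
    simp [this]
  | succ m hm ih =>
    have ha' : (0 : ℝ) < a := by exact_mod_cast ha
    have hm' : (0 : ℝ) < m := by exact_mod_cast (by omega : 0 < m)
    rw [sum_Ico_succ_top hm]
    have h := Real.log_le_sub_one_of_pos (show (0 : ℝ) < (m + 1) / m by positivity)
    have h' : ((m : ℝ) + 1) / m - 1 = 1 / m := by field_simp; ring
    have h'' : ((m + 1 : ℕ) : ℝ) / a = m / a * ((m + 1) / m) := by push_cast; field_simp
    rw [h'', Real.log_mul (by positivity) (by positivity)]
    linarith

theorem sum_Ico_le_log {a n : ℕ} (ha : 2 ≤ a) (han : a ≤ n) :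
    ∑ i ∈ Ico a n, (1 : ℝ) / i ≤ Real.log ((n - 1) / (a - 1)) := by
  have ha' : (2 : ℝ) ≤ a := by exact_mod_cast ha
  induction n, han using Nat.le_induction with
  | base =>
    have : (a : ℝ) - 1 ≠ 0 := by linarith
    simp [this]
  | succ m hm ih =>
    have hm' : (a : ℝ) ≤ m := by exact_mod_cast hm
    have h1 : (0 : ℝ) < m - 1 := by linarith
    have h2 : (0 : ℝ) < a - 1 := by linarith
    have h3 : (0 : ℝ) < m := by linarith
    rw [sum_Ico_succ_top hm]
    have h := Real.one_sub_inv_le_log_of_pos (show (0 : ℝ) < m / (m - 1) by positivity)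
    have h' : 1 - ((m : ℝ) / (m - 1))⁻¹ = 1 / m := by field_simp; ring
    have h'' : ((m + 1 : ℕ) - 1 : ℝ) / (a - 1) = (m - 1) / (a - 1) * (m / (m - 1)) := by
      push_cast; field_simp; ring
    rw [h'', Real.log_mul (by positivity) (by positivity)]
    linarith

/-- The number `r` of rejected candidates is characterized by the two harmonic sums. -/
theorem exists_threshold_eq {n : ℕ} (hn : 3 ≤ n) :
    ∃ r : ℕ, 1 ≤ r ∧ r < n ∧ threshold n = r + 1 ∧ 1 < ∑ i ∈ Ico r n, (1 : ℝ) / i ∧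
      ∑ i ∈ Ico (r + 1) n, (1 : ℝ) / i ≤ 1 := by
  set T := {t : ℕ | 1 ≤ t ∧ ∑ i ∈ Ico t n, (1 : ℝ) / (i : ℝ) ≤ 1} with hT
  have hnT : n ∈ T := ⟨by omega, by simp⟩
  have hmem : threshold n ∈ T := Nat.sInf_mem ⟨n, hnT⟩
  have hle : threshold n ≤ n := Nat.sInf_le hnT
  have h1 : threshold n ≠ 1 := by
    intro h
    have := hmem.2
    rw [h] at this
    have hsub : ∑ i ∈ Ico (1 : ℕ) 3, (1 : ℝ) / i ≤ ∑ i ∈ Ico 1 n, (1 : ℝ) / i :=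
      sum_le_sum_of_subset_of_nonneg (Ico_subset_Ico le_rfl hn) fun _ _ _ => by positivity
    norm_num [sum_Ico_succ_top] at hsub
    norm_num at this
    linarith
  have h2 := hmem.1
  refine ⟨threshold n - 1, by omega, by omega, by omega, ?_, ?_⟩
  · have : threshold n - 1 ∉ T := Nat.notMem_of_lt_sInf (show _ < threshold n by omega)
    by_contra! h
    exact this ⟨by omega, h⟩
  · rw [Nat.sub_add_cancel h2]
    exact hmem.2

/-- Together with `exp_mul_lt_of_lt_sum` this places `r` within 1 of `n / e`, which serves both the
numerical estimates and the limit. -/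
theorem le_exp_mul_of_sum_le {n r : ℕ} (hrn : r < n)
    (h : ∑ i ∈ Ico (r + 1) n, (1 : ℝ) / i ≤ 1) : (n : ℝ) ≤ Real.exp 1 * (r + 1) := by
  have h1 := (log_le_sum_Ico (by omega : 1 ≤ r + 1) hrn).trans h
  have hn : (0 : ℝ) < n := by exact_mod_cast (by omega : 0 < n)
  rw [Real.log_le_iff_le_exp (by positivity), div_le_iff₀ (by positivity)] at h1
  exact_mod_cast h1

theorem exp_mul_lt_of_lt_sum {n r : ℕ} (hr : 1 ≤ r) (hrn : r < n)
    (h : 1 < ∑ i ∈ Ico r n, (1 : ℝ) / i) : Real.exp 1 * ((r : ℝ) - 1) < n - 1 := by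
  have hrn' : (r : ℝ) < n := by exact_mod_cast hrn
  have hr1 : (1 : ℝ) ≤ r := by exact_mod_cast hr
  rcases hr.eq_or_lt with rfl | hr2
  · simp at hrn' ⊢; linarith
  have hr' : (0 : ℝ) < r - 1 := by
    have : (2 : ℝ) ≤ r := by exact_mod_cast hr2
    linarith
  have h1 := h.trans_le (sum_Ico_le_log hr2 hrn.le)
  rw [Real.lt_log_iff_exp_lt (div_pos (by linarith) hr'), lt_div_iff₀ hr'] at h1
  exact h1

/-! ### Log-convexity in the rank for large `n`. -/

/-- `n / r` times the probability that the `k`-th best of `n` candidates is chosen by the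
algorithm that rejects the first `r` candidates and then stops at the first record. -/
noncomputable def scaledProb (n r k : ℕ) : ℝ :=
  ∑ s ∈ Ico r n, (1 : ℝ) / s - ∑ i ∈ Ico 1 k, dropCoef n r i +
    if k = 1 then 0 else 1 / ((n : ℝ) - 1)

theorem scaledProb_one (n r : ℕ) : scaledProb n r 1 = ∑ s ∈ Ico r n, (1 : ℝ) / s := by
  simp [scaledProb]

theorem scaledProb_two (n r : ℕ) :
    scaledProb n r 2 = scaledProb n r 1 - (dropCoef n r 1 - 1 / ((n : ℝ) - 1)) := by
  simp [scaledProb]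
  ring

theorem scaledProb_succ {n r k : ℕ} (hk : 2 ≤ k) :
    scaledProb n r (k + 1) = scaledProb n r k - dropCoef n r k := by
  rw [scaledProb, scaledProb, sum_Ico_succ_top (by omega), if_neg (by omega), if_neg (by omega)]
  ring

theorem recordProb_eq {n r : ℕ} (hr : 1 ≤ r) (k : ℕ) (hk : k < n) :
    recordProb n r k =
      (r : ℝ) / n * (∑ s ∈ Ico r n, (1 : ℝ) / s - ∑ i ∈ Ico 1 (k + 1), dropCoef n r i) := by
  induction k with
  | zero => simp [recordProb_zero]
  | succ k ih =>
    have h := recordProb_sub_succ hr hk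
    have h' := ih (by omega)
    rw [sum_Ico_succ_top (by omega)]
    linear_combination h' - h

theorem recordProb_add_eq_scaledProb {n r : ℕ} (hr : 1 ≤ r) (k : ℕ) (hk : k < n) :
    recordProb n r k + (if k = 0 then 0 else (r : ℝ) / (n * (n - 1))) =
      (r : ℝ) / n * scaledProb n r (k + 1) := by
  rw [recordProb_eq hr k hk, scaledProb, mul_add]
  congr 1
  by_cases h : k = 0
  · simp [h]
  · rw [if_neg h, if_neg (by omega), div_mul_div_comm, mul_one]

/-- The floor is the contribution of the forced last choice, the part from records being
nonnegative. It is what saves log-convexity at large `k`. -/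
theorem le_scaledProb {n r k : ℕ} (hr : 1 ≤ r) (hk : 2 ≤ k) (hkn : k ≤ n) :
    1 / ((n : ℝ) - 1) ≤ scaledProb n r k := by
  have h := recordProb_nonneg n r (k - 1)
  rw [recordProb_eq hr _ (by omega), Nat.sub_add_cancel (by omega)] at h
  have hn : (0 : ℝ) < n := by exact_mod_cast (by omega : 0 < n)
  have hr' : (0 : ℝ) < r := by exact_mod_cast hr
  have h' := nonneg_of_mul_nonneg_right h (by positivity)
  rw [scaledProb, if_neg (by omega)]
  linarith

theorem dropCoef_add_le_scaledProb {n r k : ℕ} (hr : 1 ≤ r) (hk : 2 ≤ k) (hkn : k < n) :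
    dropCoef n r k + 1 / ((n : ℝ) - 1) ≤ scaledProb n r k := by
  have := le_scaledProb hr (by omega : 2 ≤ k + 1) (show k + 1 ≤ n by omega)
  rw [scaledProb_succ hk] at this
  linarith

/-- Passing from `k` to `k + 1` multiplies `k * dropCoef n r k` by `(n - r - k) / (n - 1 - k)`,
which `h` keeps at most `2 / 3`. -/
theorem mul_dropCoef_le_pow {n r k : ℕ} (hrn : r ≤ n) (h : 3 * ((n : ℝ) - r) ≤ 2 * (n - 1))
    (hk : 1 ≤ k) (hkn : k < n) : k * dropCoef n r k ≤ (2 / 3 : ℝ) ^ k := by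
  induction k, hk using Nat.le_induction with
  | base =>
    have hn : (1 : ℝ) < n := by exact_mod_cast hkn
    rw [dropCoef_one hrn (by omega), Nat.cast_one, one_mul, pow_one, div_le_iff₀ (by linarith)]
    linarith
  | succ k hk ih =>
    have ih' := ih (by omega)
    have h1 := dropCoef_succ hrn hk hkn
    have hkn' : (k : ℝ) + 1 < n := by exact_mod_cast hkn
    have h0 := dropCoef_nonneg n r k
    have hpos : (0 : ℝ) < n - 1 - k := by linarith
    have hk0 : (0 : ℝ) ≤ k := by positivity
    have h2 : (k : ℝ) * (n - r - k) * dropCoef n r k ≤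
        (2 / 3 * (n - 1 - k)) * (k * dropCoef n r k) := by
      have : (n : ℝ) - r - k ≤ 2 / 3 * (n - 1 - k) := by linarith
      have := mul_le_mul_of_nonneg_right this (mul_nonneg hk0 h0)
      linarith
    have h3 := mul_le_mul_of_nonneg_left ih' (by positivity : (0 : ℝ) ≤ 2 / 3 * (n - 1 - k))
    rw [pow_succ]
    push_cast
    refine le_of_mul_le_mul_left ?_ hpos
    linarith

theorem three_mul_mul_pow_le {K : ℕ} (hK : 9 ≤ K) : 3 * (K : ℝ) * (2 / 3) ^ K ≤ 1 := by
  induction K, hK using Nat.le_induction with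
  | base => norm_num
  | succ K hK ih =>
    have h : (9 : ℝ) ≤ K := by exact_mod_cast hK
    have hp : (0 : ℝ) < (2 / 3) ^ K := by positivity
    rw [pow_succ]
    push_cast
    nlinarith

/-- If the ratio of consecutive decrements decreases at `k`, then `k` is large. -/
theorem lt_sq_of_ratio_lt {n r k : ℝ} (hn : 64 ≤ n) (hk : 0 ≤ k) (hr : 1 ≤ r)
    (hr' : 2.718 * (r - 1) ≤ n)
    (h : (k + 1) * (n - r - (k + 1)) * ((k + 1) * (n - 1 - k)) <
      k * (n - r - k) * ((k + 2) * (n - 1 - (k + 1)))) : n < (k + 1) ^ 2 := by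
  -- Rearrangement of `h` using `k * (k + 2) = (k + 1) ^ 2 - 1`. If `(k + 1) ^ 2 ≤ n`, the left side
  -- is at least `0.4 * n ^ 2` and the right side at most `n ^ 2 / 2.718`, which is smaller.
  have h1 : (n - r - k) * (n - 2 - k) < (k + 1) ^ 2 * (r - 1) := by nlinarith
  by_contra! hle
  have h8 : 8 * (k + 1) ≤ n := by nlinarith
  have h2 : 0.5 * n ≤ n - r - k := by linarith
  have h3 : 0.8 * n ≤ n - 2 - k := by linarith
  have h4 : (0.5 * n) * (0.8 * n) ≤ (n - r - k) * (n - 2 - k) :=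
    mul_le_mul h2 h3 (by linarith) (by linarith)
  have h5 : (k + 1) ^ 2 * (r - 1) ≤ n * (r - 1) := mul_le_mul_of_nonneg_right hle (by linarith)
  nlinarith

/-- With `G, D, D'` the value and two successive drops, this is `(G - D) ^ 2 ≤ G * (G - D - D')`.
For `D > 0` and `ρ = D' / D` it reads `D ≤ G * (1 - ρ)`. The induction descends from `k = n - r`,
beyond which drops vanish. If the ratio does not decrease from `k` to `k + 1`, the inequality at `k
+ 1` passes down to `k`. If it decreases, `lt_sq_of_ratio_lt` makes `k` so large that `D'` is
negligible against the floor `1 / (n - 1)`. -/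
theorem sq_dropCoef_le_of_large {n r : ℕ} (hn : 64 ≤ n) (hr : 2 ≤ r) (hrn : r < n)
    (h₁ : (n : ℝ) ≤ 2.719 * (r + 1)) (h₂ : 2.718 * ((r : ℝ) - 1) ≤ n) {k : ℕ} (hk : 2 ≤ k)
    (hkn : k + 2 ≤ n) :
    dropCoef n r k ^ 2 ≤ scaledProb n r k * (dropCoef n r k - dropCoef n r (k + 1)) := by
  have hn' : (64 : ℝ) ≤ n := by exact_mod_cast hn
  have h23 : 3 * ((n : ℝ) - r) ≤ 2 * (n - 1) := by linarith
  have hc : (0 : ℝ) < 1 / ((n : ℝ) - 1) := by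
    have : (0 : ℝ) < n - 1 := by linarith
    positivity
  rcases le_or_gt (n - r) k with hkr | hkr
  · have h0 := dropCoef_nonneg n r k
    have := dropCoef_add_le_scaledProb (by omega : 1 ≤ r) hk (by omega : k < n)
    rw [dropCoef_eq_zero (by omega : n - r < k + 1)]
    nlinarith
  · refine Nat.decreasingInduction' (n := n - r) (m := k) (P := fun k => 2 ≤ k →
      dropCoef n r k ^ 2 ≤ scaledProb n r k * (dropCoef n r k - dropCoef n r (k + 1)))
      ?_ hkr.le ?_ hk
    · clear hk hkn hkr
      intro k hkr _ ih hk
      replace ih := ih (by omega)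
      have hk' : (2 : ℝ) ≤ k := by exact_mod_cast hk
      have hkr' : (k : ℝ) + r + 1 ≤ n := by exact_mod_cast (by omega : k + r + 1 ≤ n)
      have hr2 : (2 : ℝ) ≤ r := by exact_mod_cast hr
      have hD := dropCoef_pos (by omega : 1 ≤ r) (by omega : 1 ≤ k) hkr.le
      have hD' := dropCoef_pos (by omega : 1 ≤ r) (by omega : 1 ≤ k + 1)
        (show k + 1 ≤ n - r by omega)
      have e1 := dropCoef_succ hrn.le (by omega : 1 ≤ k) (by omega : k + 1 < n)
      have e2 := dropCoef_succ hrn.le (by omega : 1 ≤ k + 1) (by omega : k + 1 + 1 < n)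
      have hG := scaledProb_succ (n := n) (r := r) hk
      have hGk := dropCoef_add_le_scaledProb (by omega : 1 ≤ r) hk (by omega : k < n)
      have hGk' := le_scaledProb (by omega : 1 ≤ r) (by omega : 2 ≤ k + 1)
        (by omega : k + 1 ≤ n)
      have hpow := mul_dropCoef_le_pow hrn.le h23 (by omega : 1 ≤ k + 1) (by omega : k + 1 < n)
      push_cast at e2
      set D := dropCoef n r k
      set D' := dropCoef n r (k + 1)
      set D'' := dropCoef n r (k + 1 + 1)
      set G := scaledProb n r k
      set G' := scaledProb n r (k + 1)
      set ρ : ℝ := k * (n - r - k) / ((k + 1) * (n - 1 - k)) with hρ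
      set ρ' : ℝ := (k + 1) * (n - r - (k + 1)) / ((k + 2) * (n - 1 - (k + 1))) with hρ'
      have hp1 : (0 : ℝ) < (k + 1) * (n - 1 - k) := mul_pos (by linarith) (by linarith)
      have hp2 : (0 : ℝ) < (k + 2) * (n - 1 - (k + 1)) := mul_pos (by linarith) (by linarith)
      have d1 : D' = ρ * D := by
        rw [hρ, div_mul_eq_mul_div, eq_div_iff hp1.ne']; linarith
      have d2 : D'' = ρ' * D' := by
        rw [hρ', div_mul_eq_mul_div, eq_div_iff hp2.ne']; linarith
      have hgoal : D ≤ G * (1 - ρ) := by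
        rcases le_or_gt ρ ρ' with hle | hlt
        -- As `G = D + G'` and `D' = ρ * D`, the goal is equivalent to `D' ≤ G' * (1 - ρ)`.
        · have ih' : D' ≤ G' * (1 - ρ') := by
            rw [d2] at ih
            refine le_of_mul_le_mul_right ?_ hD'
            linarith
          have : G' * (1 - ρ') ≤ G' * (1 - ρ) :=
            mul_le_mul_of_nonneg_left (by linarith) (hc.le.trans hGk')
          have hG2 : G = D + G' := by linarith
          rw [hG2]
          linarith
        · rw [hρ, hρ', div_lt_div_iff₀ hp2 hp1] at hlt
          have hsq := lt_sq_of_ratio_lt hn' (by linarith) (by linarith) h₂ hlt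
          have hK : 9 ≤ k + 1 := by
            by_contra! h
            have : (k : ℝ) + 1 ≤ 8 := by exact_mod_cast (by omega : k + 1 ≤ 8)
            have := pow_le_pow_left₀ (by linarith) this 2
            linarith
          have h3 := three_mul_mul_pow_le hK
          push_cast at h3 hpow
          have hρle : ρ ≤ 2 / 3 := by
            rw [hρ, div_le_iff₀ hp1]
            have : (k : ℝ) * (n - r - k) ≤ k * (2 / 3 * (n - 1 - k)) :=
              mul_le_mul_of_nonneg_left (by linarith) (by linarith)
            linarith
          -- `D' * (n - 1) ≤ D' * (k + 1) ^ 2 ≤ (k + 1) * (2 / 3) ^ (k + 1) ≤ 1 / 3 ≤ 1 - ρ`.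
          have hkey : D' ≤ 1 / ((n : ℝ) - 1) * (1 - ρ) := by
            have hn1 : (0 : ℝ) < n - 1 := by linarith
            rw [div_mul_eq_mul_div, one_mul, le_div_iff₀ hn1]
            have hk1 : (0 : ℝ) < (k : ℝ) + 1 := by linarith
            have t1 : D' * ((n : ℝ) - 1) ≤ D' * ((k : ℝ) + 1) ^ 2 :=
              mul_le_mul_of_nonneg_left (by linarith) hD'.le
            have t2 : ((k : ℝ) + 1) * ((k + 1) * D') ≤ ((k : ℝ) + 1) * (2 / 3) ^ (k + 1) :=
              mul_le_mul_of_nonneg_left hpow hk1.le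
            linarith
          have t : (D + 1 / ((n : ℝ) - 1)) * (1 - ρ) ≤ G * (1 - ρ) :=
            mul_le_mul_of_nonneg_right hGk (by linarith)
          linarith
      have := mul_le_mul_of_nonneg_right hgoal hD.le
      rw [d1]
      linarith
    · intro hk2
      have h0 := dropCoef_nonneg n r (n - r)
      have := dropCoef_add_le_scaledProb (by omega : 1 ≤ r) hk2 (by omega : n - r < n)
      rw [dropCoef_eq_zero (by omega : n - r < n - r + 1)]
      nlinarith

/-- The corrected first drop is `y = (n - r - 1) / (n - 1)` and the second is `y * z`, so `y ≤ H *
(1 - z)` suffices. With `H > 1` this follows from `y ≤ 0.645` and `z ≤ 0.345`, which lie just above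
the limits `1 - 1/e` and `(1 - 1/e) / 2`. -/
theorem sq_first_le_of_large {n r : ℕ} (hn : 64 ≤ n) (hrn : r < n)
    (h₁ : (n : ℝ) ≤ 2.719 * (r + 1)) (hH : 1 < ∑ i ∈ Ico r n, (1 : ℝ) / i) :
    (dropCoef n r 1 - 1 / ((n : ℝ) - 1)) ^ 2 ≤
      scaledProb n r 1 * (dropCoef n r 1 - 1 / ((n : ℝ) - 1) - dropCoef n r 2) := by
  have hn' : (64 : ℝ) ≤ n := by exact_mod_cast hn
  have hrn' : (r : ℝ) + 1 ≤ n := by exact_mod_cast hrn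
  have e1 := dropCoef_succ hrn.le le_rfl (by omega : 1 + 1 < n)
  rw [dropCoef_one hrn.le (by omega)] at e1 ⊢
  have hn1 : (0 : ℝ) < n - 1 := by linarith
  have hn2 : (0 : ℝ) < n - 2 := by linarith
  have e2 : dropCoef n r 2 = ((n : ℝ) - r - 1) / (n - 1) * ((n - r) / (2 * (n - 2))) := by
    norm_num at e1
    rw [div_mul_div_comm, eq_div_iff (by positivity)]
    field_simp at e1
    linarith
  rw [scaledProb_one, ← sub_div, e2]
  set H := ∑ i ∈ Ico r n, (1 : ℝ) / i
  set y : ℝ := ((n : ℝ) - r - 1) / (n - 1)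
  set z : ℝ := ((n : ℝ) - r) / (2 * (n - 2))
  have hy0 : 0 ≤ y := div_nonneg (by linarith) hn1.le
  have hy : y ≤ 0.645 := by
    rw [div_le_iff₀ hn1]; linarith
  have hz : z ≤ 0.345 := by
    rw [div_le_iff₀ (by positivity)]; linarith
  have : y ≤ H * (1 - z) := by nlinarith
  nlinarith

/-! ### Log-convexity for `n < 64` by computation, and the combined statement. -/

/-- Test of the log-convexity of `scaledProb n r` at the `f` indices from `k` on, where `D` and `G`
are a common multiple of `dropCoef n r k` and `scaledProb n r k`. -/
def logConvexTest (n r : ℕ) : ℕ → ℕ → ℕ → ℕ → Bool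
  | 0, _, _, _ => true
  | f + 1, k, D, G =>
    let D' := k * (n - r - k) * D / ((k + 1) * (n - 1 - k))
    -- Division in `ℕ` truncates; this test certifies that it was exact.
    decide (D' * ((k + 1) * (n - 1 - k)) = k * (n - r - k) * D) &&
      (decide (D ^ 2 + G * D' ≤ G * D) && logConvexTest n r f (k + 1) D' (G - D))

/-- Test of the log-convexity of `scaledProb n r` in integer arithmetic. -/
def logConvexTestAll (n r : ℕ) : Bool :=
  -- A scale clearing denominators: divisibility by each `s` in the harmonic sum is proved later,
  -- exactness of the later divisions is tested.
  let Z := (n - 1).factorial ^ 2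
  let H := ∑ s ∈ Ico r n, Z / s
  let c := Z / (n - 1)
  let D₁ := (n - r) * c
  let D₂ := (n - r - 1) * D₁ / (2 * (n - 2))
  decide (D₂ * (2 * (n - 2)) = (n - r - 1) * D₁) &&
    (decide ((D₁ - c) ^ 2 + H * D₂ ≤ H * (D₁ - c)) &&
      logConvexTest n r (n - 3) 2 D₂ (H - (D₁ - c)))

/-- The conditions on `r` are rational relaxations of `n ≤ e * (r + 1)` and `e * (r - 1) ≤ n`, so no
harmonic sum has to be compared with 1. -/
theorem logConvexTestAll_of_lt : ∀ n < 64, 7 ≤ n → ∀ r < n, 1000 * n ≤ 2719 * (r + 1) →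
    2718 * (r - 1) ≤ 1000 * n → logConvexTestAll n r = true := by
  decide +kernel

theorem cast_eq_mul_dropCoef_succ {n r k : ℕ} (hrn : r ≤ n) (hk : 1 ≤ k) (hkn : k + 1 < n)
    {D D' : ℕ} {Z : ℝ} (hD : (D : ℝ) = Z * dropCoef n r k)
    (h : D' * ((k + 1) * (n - 1 - k)) = k * (n - r - k) * D) :
    (D' : ℝ) = Z * dropCoef n r (k + 1) := by
  have e := dropCoef_succ hrn hk hkn
  have hkn' : (k : ℝ) + 1 < n := by exact_mod_cast hkn
  have hp : (0 : ℝ) < (k + 1) * (n - 1 - k) := mul_pos (by positivity) (by linarith)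
  have h' := congrArg (Nat.cast : ℕ → ℝ) h
  push_cast [hD, Nat.cast_sub (show k ≤ n - 1 by omega), Nat.cast_sub (show 1 ≤ n by omega)] at h'
  refine mul_right_cancel₀ hp.ne' ?_
  rw [h']
  rcases le_or_gt k (n - r) with hle | hlt
  · rw [Nat.cast_sub hle, Nat.cast_sub hrn]
    linear_combination -Z * e
  · rw [dropCoef_eq_zero hlt, dropCoef_eq_zero (by omega)]
    simp

theorem sq_dropCoef_le_of_logConvexTest {n r : ℕ} (hr : 1 ≤ r) (hrn : r ≤ n) {Z : ℝ} (hZ : 0 < Z) :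
    ∀ f k D G : ℕ, 2 ≤ k → k + f + 1 ≤ n → (D : ℝ) = Z * dropCoef n r k →
    (G : ℝ) = Z * scaledProb n r k → logConvexTest n r f k D G = true → ∀ j < f,
      dropCoef n r (k + j) ^ 2 ≤
        scaledProb n r (k + j) * (dropCoef n r (k + j) - dropCoef n r (k + j + 1)) := by
  intro f
  induction f with
  | zero => intro _ _ _ _ _ _ _ _ j hj; omega
  | succ f ih =>
    intro k D G hk hkf hD hG htest j hj
    simp only [logConvexTest, Bool.and_eq_true, decide_eq_true_eq] at htest
    obtain ⟨h₀, h₁, h₂⟩ := htest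
    have hD' := cast_eq_mul_dropCoef_succ hrn (by omega : 1 ≤ k) (by omega : k + 1 < n) hD h₀
    generalize k * (n - r - k) * D / ((k + 1) * (n - 1 - k)) = D' at h₁ h₂ hD'
    cases j with
    | zero =>
      have h₃ : (D : ℝ) ^ 2 + G * D' ≤ G * D := by exact_mod_cast h₁
      rw [hD, hG, hD'] at h₃
      refine le_of_mul_le_mul_left ?_ (pow_pos hZ 2)
      rw [add_zero]
      linarith
    | succ j =>
      have hn1 : (0 : ℝ) ≤ 1 / ((n : ℝ) - 1) := by
        have : (1 : ℝ) ≤ n := by exact_mod_cast (by omega : 1 ≤ n)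
        exact div_nonneg zero_le_one (by linarith)
      have hle := dropCoef_add_le_scaledProb hr hk (by omega : k < n)
      -- Ensures that the natural subtraction `G - D` is not truncated.
      have hDG : D ≤ G := by
        have : (D : ℝ) ≤ G := by
          rw [hD, hG]
          exact mul_le_mul_of_nonneg_left (by linarith) hZ.le
        exact_mod_cast this
      have := ih (k + 1) D' (G - D) (by omega) (by omega) hD'
        (by rw [Nat.cast_sub hDG, hD, hG, scaledProb_succ hk]; ring) h₂ j (by omega)
      rwa [show k + 1 + j = k + (j + 1) by ring] at this

theorem sq_le_of_logConvexTestAll {n r : ℕ} (hn : 3 ≤ n) (hr : 1 ≤ r) (hrn : r < n)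
    (h : logConvexTestAll n r = true) :
    (dropCoef n r 1 - 1 / ((n : ℝ) - 1)) ^ 2 ≤
      scaledProb n r 1 * (dropCoef n r 1 - 1 / ((n : ℝ) - 1) - dropCoef n r 2) ∧
      ∀ k, 2 ≤ k → k + 2 ≤ n →
        dropCoef n r k ^ 2 ≤ scaledProb n r k * (dropCoef n r k - dropCoef n r (k + 1)) := by
  simp only [logConvexTestAll, Bool.and_eq_true, decide_eq_true_eq] at h
  have hdvd : ∀ s ∈ Ico r n, s ∣ (n - 1).factorial ^ 2 := fun s hs => by
    have := mem_Ico.1 hs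
    exact (Nat.dvd_factorial (by omega) (by omega)).trans (dvd_pow_self _ two_ne_zero)
  have hZ : (0 : ℝ) < ((n - 1).factorial ^ 2 : ℕ) := by
    exact_mod_cast pow_pos (n - 1).factorial_pos 2
  generalize (n - 1).factorial ^ 2 = Z at h hdvd hZ
  have hn1 : ((n - 1 : ℕ) : ℝ) = n - 1 := by rw [Nat.cast_sub (by omega), Nat.cast_one]
  have hn2 : (3 : ℝ) ≤ n := by exact_mod_cast hn
  have hn3 : (n : ℝ) - 1 ≠ 0 := by linarith
  have hc : ((Z / (n - 1) : ℕ) : ℝ) = Z * (1 / ((n : ℝ) - 1)) := by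
    rw [Nat.cast_div (hdvd _ (mem_Ico.2 (by omega))) (by rw [hn1]; exact hn3), hn1]
    ring
  have hH : ((∑ s ∈ Ico r n, Z / s : ℕ) : ℝ) = Z * scaledProb n r 1 := by
    rw [scaledProb_one, Nat.cast_sum, mul_sum]
    refine sum_congr rfl fun s hs => ?_
    have hs0 : (s : ℝ) ≠ 0 := by
      have := mem_Ico.1 hs
      exact_mod_cast (by omega : s ≠ 0)
    rw [Nat.cast_div (hdvd s hs) hs0]
    ring
  generalize Z / (n - 1) = c at h hc
  generalize ∑ s ∈ Ico r n, Z / s = H at h hH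
  have hD₁ : (((n - r) * c : ℕ) : ℝ) = Z * dropCoef n r 1 := by
    rw [dropCoef_one hrn.le (by omega), Nat.cast_mul, hc, Nat.cast_sub hrn.le]
    ring
  obtain ⟨h₀, h₁, h₂⟩ := h
  generalize (n - r - 1) * ((n - r) * c) / (2 * (n - 2)) = D₂ at h₀ h₁ h₂
  have hD₂ := cast_eq_mul_dropCoef_succ hrn.le le_rfl (by omega : 1 + 1 < n) hD₁
    (D' := D₂) (by rw [one_mul, ← h₀, show n - 1 - 1 = n - 2 by omega])
  have he : (((n - r) * c - c : ℕ) : ℝ) = Z * (dropCoef n r 1 - 1 / ((n : ℝ) - 1)) := by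
    rw [Nat.cast_sub (Nat.le_mul_of_pos_left c (by omega)), hD₁, hc]
    ring
  generalize (n - r) * c - c = e at h₁ h₂ he
  constructor
  · have h₃ : (e : ℝ) ^ 2 + H * D₂ ≤ H * e := by exact_mod_cast h₁
    rw [he, hH, hD₂] at h₃
    refine le_of_mul_le_mul_left ?_ (pow_pos hZ 2)
    linarith
  · intro k hk hkn
    have hG : (H : ℝ) - e = Z * scaledProb n r 2 := by
      rw [scaledProb_two, he, hH]
      ring
    have heH : e ≤ H := by
      have h₄ := le_scaledProb hr le_rfl (by omega : 2 ≤ n)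
      have h₅ : (0 : ℝ) ≤ 1 / ((n : ℝ) - 1) := div_nonneg zero_le_one (by linarith)
      have h₆ := mul_nonneg hZ.le (h₅.trans h₄)
      have : (e : ℝ) ≤ H := by linarith
      exact_mod_cast this
    have := sq_dropCoef_le_of_logConvexTest hr hrn.le hZ (n - 3) 2 _ _ le_rfl (by omega) hD₂
      (by rw [Nat.cast_sub heH, hG]) h₂ (k - 2) (by omega)
    rwa [show 2 + (k - 2) = k by omega] at this

theorem scaledProb_logConvex {n r : ℕ} (hn : 7 ≤ n) (hr : 2 ≤ r) (hrn : r < n)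
    (hH : 1 < ∑ i ∈ Ico r n, (1 : ℝ) / i) (hH' : ∑ i ∈ Ico (r + 1) n, (1 : ℝ) / i ≤ 1) {k : ℕ}
    (hk : 1 ≤ k) (hkn : k + 2 ≤ n) :
    scaledProb n r (k + 1) ^ 2 ≤ scaledProb n r k * scaledProb n r (k + 2) := by
  have hr' : (2 : ℝ) ≤ r := by exact_mod_cast hr
  have h₁ : (n : ℝ) ≤ 2.719 * (r + 1) :=
    (le_exp_mul_of_sum_le hrn hH').trans
      (mul_le_mul_of_nonneg_right (by linarith [Real.exp_one_lt_d9]) (by positivity))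
  have h₂ : 2.718 * ((r : ℝ) - 1) ≤ n := by
    have := exp_mul_lt_of_lt_sum (by omega) hrn hH
    have : 2.718 * ((r : ℝ) - 1) ≤ Real.exp 1 * (r - 1) :=
      mul_le_mul_of_nonneg_right (by linarith [Real.exp_one_gt_d9]) (by linarith)
    linarith
  have main : (dropCoef n r 1 - 1 / ((n : ℝ) - 1)) ^ 2 ≤
      scaledProb n r 1 * (dropCoef n r 1 - 1 / ((n : ℝ) - 1) - dropCoef n r 2) ∧
      ∀ k, 2 ≤ k → k + 2 ≤ n →
        dropCoef n r k ^ 2 ≤ scaledProb n r k * (dropCoef n r k - dropCoef n r (k + 1)) := by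
    rcases le_or_gt 64 n with hn64 | hn64
    · exact ⟨sq_first_le_of_large hn64 hrn h₁ hH,
        fun k => sq_dropCoef_le_of_large hn64 hr hrn h₁ h₂⟩
    · have h₁' : 1000 * n ≤ 2719 * (r + 1) := by
        have : (1000 : ℝ) * n ≤ 2719 * (r + 1) := by linarith
        exact_mod_cast this
      have h₂' : 2718 * (r - 1) ≤ 1000 * n := by
        have : (2718 : ℝ) * ((r - 1 : ℕ) : ℝ) ≤ 1000 * n := by
          rw [Nat.cast_sub (by omega)]; push_cast; linarith
        exact_mod_cast this
      exact sq_le_of_logConvexTestAll (by omega) (by omega) hrn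
        (logConvexTestAll_of_lt n hn64 hn r hrn h₁' h₂')
  rcases hk.eq_or_lt with rfl | hk2
  · have h := main.1
    have e := scaledProb_two n r
    have e' := scaledProb_succ (n := n) (r := r) (le_refl 2)
    simp only [Nat.reduceAdd] at e' ⊢
    rw [e', e]
    nlinarith
  · have h := main.2 k hk2 hkn
    have e := scaledProb_succ (n := n) (r := r) hk2
    have e' := scaledProb_succ (n := n) (r := r) (by omega : 2 ≤ k + 1)
    rw [show k + 2 = k + 1 + 1 by ring, e', e]
    nlinarith

/-! ### From log-convexity to privacy. -/

/-- The ratios `q (k + 1) / q k` are nondecreasing, so the relative loss over a shift by `m` is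
greatest when the shift starts at 1. -/
theorem mul_le_mul_of_logConvex {q : ℕ → ℝ} {n : ℕ} (hpos : ∀ k, 1 ≤ k → k ≤ n → 0 < q k)
    (hlc : ∀ k, 1 ≤ k → k + 2 ≤ n → q (k + 1) ^ 2 ≤ q k * q (k + 2)) (a m : ℕ)
    (h : 1 + a + m ≤ n) : q (1 + a) * q (1 + m) ≤ q 1 * q (1 + a + m) := by
  have step : ∀ m k, 1 ≤ k → k + m + 1 ≤ n → q (k + 1) * q (k + m) ≤ q k * q (k + m + 1) := by
    intro m
    induction m with
    | zero => intro k _ _; simp [mul_comm]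
    | succ m ih =>
      intro k hk hkn
      have h₁ := ih k hk (by omega)
      have h₂ := hlc (k + m) (by omega) (by omega)
      have p₁ := hpos (k + 1) (by omega) (by omega)
      have p₂ := hpos (k + m + 1) (by omega) (by omega)
      have p₃ := hpos (k + m + 2) (by omega) (by omega)
      have h₃ := mul_le_mul_of_nonneg_left h₂ p₁.le
      have h₄ := mul_le_mul_of_nonneg_right h₁ p₃.le
      rw [← add_assoc, show k + m + 1 + 1 = k + m + 2 by ring]
      refine le_of_mul_le_mul_right ?_ p₂
      linarith
  induction a with
  | zero => simp
  | succ a ih =>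
    have h₁ := ih (by omega)
    have h₂ := step m (1 + a) (by omega) (by omega)
    have p₁ := hpos (1 + a) (by omega) (by omega)
    have p₂ := hpos (1 + a + 1) (by omega) (by omega)
    have p₃ := hpos 1 (by omega) (by omega)
    have h₃ := mul_le_mul_of_nonneg_left h₁ p₂.le
    have h₄ := mul_le_mul_of_nonneg_left h₂ p₃.le
    rw [show 1 + (a + 1) = 1 + a + 1 by ring, show 1 + a + 1 + m = 1 + a + m + 1 by ring]
    refine le_of_mul_le_mul_right ?_ p₁
    linarith

/-- First `q i ≤ R * q j` with `R = q 1 / q (l + 1)`: by monotonicity if `j ≤ l + 1`, and otherwise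
by lowering `i` to `j - l` and using log-convexity. When `exp ε < R` and `j > l + 1`, the difference
is at most `(R - exp ε) * q j ≤ (R - exp ε) * q (l + 1)`. -/
theorem sub_exp_mul_le_of_logConvex {q : ℕ → ℝ} {n l : ℕ} (hpos : ∀ k, 1 ≤ k → k ≤ n → 0 < q k)
    (hlc : ∀ k, 1 ≤ k → k + 2 ≤ n → q (k + 1) ^ 2 ≤ q k * q (k + 2))
    (hanti : ∀ i j, 1 ≤ i → i ≤ j → j ≤ n → q j ≤ q i) (hln : l < n) {ε δ : ℝ}
    (hδ : (if ε < Real.log (q 1 / q (l + 1)) then q 1 - Real.exp ε * q (l + 1) else 0) ≤ δ)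
    {i j : ℕ} (hi : 1 ≤ i) (hin : i ≤ n) (hj : 1 ≤ j) (hjn : j ≤ n) (hij : j ≤ i + l) :
    q i - Real.exp ε * q j ≤ δ := by
  have p₁ := hpos 1 le_rfl (by omega)
  have p₂ := hpos (l + 1) (by omega) (by omega)
  have pj := hpos j hj hjn
  have hq1 := hanti 1 i le_rfl hi hin
  have hR : 0 < q 1 / q (l + 1) := by positivity
  have hratio : q i ≤ q 1 / q (l + 1) * q j := by
    rw [div_mul_eq_mul_div, le_div_iff₀ p₂]
    rcases le_or_gt j (l + 1) with hjl | hjl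
    · exact mul_le_mul hq1 (hanti j (l + 1) hj hjl (by omega)) p₂.le p₁.le
    · have h := mul_le_mul_of_logConvex hpos hlc (j - 1 - l) l (by omega)
      rw [show 1 + (j - 1 - l) + l = j by omega, add_comm 1 l] at h
      have h' := hanti (1 + (j - 1 - l)) i (by omega) (by omega) hin
      exact (mul_le_mul_of_nonneg_right h' p₂.le).trans h
  refine le_trans ?_ hδ
  split_ifs with hε
  · rw [Real.lt_log_iff_exp_lt hR] at hε
    rcases le_or_gt j (l + 1) with hjl | hjl
    · have := mul_le_mul_of_nonneg_left (hanti j (l + 1) hj hjl (by omega)) (Real.exp_pos ε).le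
      linarith
    · have h := mul_le_mul_of_nonneg_left (hanti (l + 1) j (by omega) hjl.le hjn)
        (sub_nonneg.2 hε.le)
      have h' : q 1 / q (l + 1) * q (l + 1) = q 1 := div_mul_cancel₀ _ p₂.ne'
      linarith
  · rw [not_lt, Real.log_le_iff_le_exp hR] at hε
    have := mul_le_mul_of_nonneg_right hε pj.le
    linarith

/-- After expansion only the cross terms need `2 * y ≤ x + z`, which is AM-GM. It allows the
constant share of the blind choice to be added. -/
theorem affine_logConvex {x y z a b : ℝ} (hx : 0 ≤ x) (hz : 0 ≤ z) (ha : 0 ≤ a)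
    (hb : 0 ≤ b) (h : y ^ 2 ≤ x * z) :
    (a * y + b) ^ 2 ≤ (a * x + b) * (a * z + b) := by
  have h₁ : 2 * y ≤ x + z := by
    refine le_of_sq_le_sq ?_ (by positivity)
    nlinarith [sq_nonneg (x - z)]
  have h₂ := mul_le_mul_of_nonneg_left h (sq_nonneg a)
  have h₃ := mul_le_mul_of_nonneg_left h₁ (mul_nonneg ha hb)
  nlinarith

/-- The probability that the `k`-th best of `n` candidates is chosen by the `p`-mix of the blind
choice and the algorithm that rejects the first `r` candidates. -/
noncomputable def mixedProb (n r : ℕ) (p : ℝ) (k : ℕ) : ℝ :=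
  p * (r / n) * scaledProb n r k + (1 - p) * (1 / n)

theorem scaledProb_antitone {n r : ℕ} (hrn : r < n) (hn : 2 ≤ n) {i j : ℕ}
    (hi : 1 ≤ i) (hij : i ≤ j) : scaledProb n r j ≤ scaledProb n r i := by
  induction j, hij using Nat.le_induction with
  | base => exact le_rfl
  | succ j hij ih =>
    refine le_trans ?_ ih
    rcases (hi.trans hij).eq_or_lt with rfl | hj
    · rw [scaledProb_two, dropCoef_one hrn.le (by omega), ← sub_div]
      have h₁ : (r : ℝ) + 1 ≤ n := by exact_mod_cast hrn
      have h₂ : (2 : ℝ) ≤ n := by exact_mod_cast hn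
      have : 0 ≤ ((n : ℝ) - r - 1) / (n - 1) := div_nonneg (by linarith) (by linarith)
      linarith
    · rw [scaledProb_succ hj]
      have := dropCoef_nonneg n r j
      linarith

theorem scaledProb_pos {n r k : ℕ} (hr : 1 ≤ r) (hrn : r < n) (hk : 1 ≤ k) (hkn : k ≤ n) :
    0 < scaledProb n r k := by
  have hn : (2 : ℝ) ≤ n := by exact_mod_cast (by omega : 2 ≤ n)
  have h := le_scaledProb hr (by omega : 2 ≤ n) le_rfl
  have h' := scaledProb_antitone hrn (by omega) hk hkn
  have : 0 < 1 / ((n : ℝ) - 1) := by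
    have : (0 : ℝ) < n - 1 := by linarith
    positivity
  linarith

theorem selectProb_eq_sum_mixedProb {n r : ℕ} [NeZero n] (hr : threshold n = r + 1) (hr0 : 1 ≤ r)
    (hrn : r < n) (p : unitInterval) (σ : CandOrder n) (S : Set (Fin n))
    [DecidablePred (· ∈ S)] :
    selectProb (pMix p (secretary n) (blindChoice n)) σ S =
      ∑ c : Fin n with c ∈ S, mixedProb n r p (rank σ c) := by
  rw [selectProb_pMix]
  refine sum_congr rfl fun c _ => ?_
  rw [card_secretary_eq hr hr0 hrn, card_blindChoice_eq,
    recordProb_add_eq_scaledProb hr0 _ (σ.symm c).isLt, mixedProb, rank]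
  ring

theorem qProb_eq_mixedProb {n r : ℕ} [NeZero n] (hr : threshold n = r + 1) (hr0 : 1 ≤ r)
    (hrn : r < n) (p : unitInterval) (σ : CandOrder n) {k : ℕ} (hk : 1 ≤ k) (hkn : k ≤ n) :
    qProb p σ k = mixedProb n r p k := by
  rw [qProb, selectProb_eq_sum_mixedProb hr hr0 hrn,
    sum_eq_single_of_mem (σ ⟨k - 1, by omega⟩)]
  · simp only [rank, Equiv.symm_apply_apply]
    rw [Nat.sub_add_cancel hk]
  · refine mem_filter.2 ⟨mem_univ _, ?_⟩
    change ((σ.symm (σ ⟨k - 1, by omega⟩) : Fin n) : ℕ) + 1 = k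
    rw [Equiv.symm_apply_apply]
    exact Nat.sub_add_cancel hk
  · intro c hc hne
    have hc' : ((σ.symm c : Fin n) : ℕ) + 1 = k := (mem_filter.1 hc).2
    refine absurd ?_ hne
    rw [← Equiv.symm_apply_eq]
    exact Fin.ext (by simp; omega)

theorem eq_or_swap_of_lDist_le_one {n l : ℕ} (hl : 1 ≤ l) {σ ρ : CandOrder n}
    (h : lDist l σ ρ ≤ 1) :
    σ = ρ ∨ ∃ a b : Fin n, a ≠ b ∧ Nat.dist (rank ρ a) (rank ρ b) ≤ l ∧
      σ = Equiv.swap a b * ρ := by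
  -- The set is nonempty because `l ≥ 1`, so the infimum is attained and is not the default value 0.
  have hmem : Reaches l ρ (lDist l σ ρ) σ := Nat.sInf_mem (exists_reaches hl σ ρ)
  generalize lDist l σ ρ = k at h hmem
  cases hmem with
  | refl => exact Or.inl rfl
  | @step k τ a b hτ hab hd =>
    obtain rfl : k = 0 := by omega
    cases hτ
    exact Or.inr ⟨a, b, hab, hd, rfl⟩

theorem rank_swap_mul {n : ℕ} (ρ : CandOrder n) (a b c : Fin n) :
    rank (Equiv.swap a b * ρ) c = rank ρ (Equiv.swap a b c) := by
  rw [rank, rank, ← Equiv.Perm.inv_def, mul_inv_rev, Equiv.swap_inv]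
  rfl

/-- The swap changes the sum only if `S` contains exactly one of `a` and `b`, and then `h₁` or `h₂`
pays for it; all other terms use `exp ε ≥ 1`. -/
theorem sum_swap_le {α : Type*} [DecidableEq α] (f : α → ℝ) {ε δ : ℝ} (hε : 0 ≤ ε) (hδ : 0 ≤ δ)
    (hf : ∀ c, 0 ≤ f c) {a b : α} (hab : a ≠ b) (h₁ : f a - Real.exp ε * f b ≤ δ)
    (h₂ : f b - Real.exp ε * f a ≤ δ) (S : Finset α) :
    ∑ c ∈ S, f (Equiv.swap a b c) ≤ Real.exp ε * ∑ c ∈ S, f c + δ := by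
  have he : 1 ≤ Real.exp ε := Real.one_le_exp hε
  have hle : ∀ x, 0 ≤ x → x ≤ Real.exp ε * x := fun x hx => le_mul_of_one_le_left hx he
  have hrest : ∑ c ∈ (S.erase a).erase b, f (Equiv.swap a b c) ≤
      Real.exp ε * ∑ c ∈ (S.erase a).erase b, f c := by
    rw [mul_sum]
    refine sum_le_sum fun c hc => ?_
    obtain ⟨hcb, hc'⟩ := mem_erase.1 hc
    rw [Equiv.swap_apply_of_ne_of_ne (mem_erase.1 hc').1 hcb]
    exact hle _ (hf c)
  have split : ∀ g : α → ℝ, ∑ c ∈ S, g c =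
      (if a ∈ S then g a else 0) + (if b ∈ S then g b else 0) +
        ∑ c ∈ (S.erase a).erase b, g c := by
    intro g
    have hb : (b ∈ S.erase a) = (b ∈ S) := by simp [hab.symm]
    have e₁ : ∑ c ∈ S, g c = (if a ∈ S then g a else 0) + ∑ c ∈ S.erase a, g c := by
      split_ifs with h
      · rw [add_sum_erase _ _ h]
      · rw [erase_eq_of_notMem h, zero_add]
    have e₂ : ∑ c ∈ S.erase a, g c =
        (if b ∈ S then g b else 0) + ∑ c ∈ (S.erase a).erase b, g c := by
      split_ifs with h
      · rw [add_sum_erase _ _ (hb ▸ h)]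
      · rw [erase_eq_of_notMem (a := b) (hb ▸ h), zero_add]
    rw [e₁, e₂, add_assoc]
  rw [split f, split fun c => f (Equiv.swap a b c)]
  have ha := hle _ (hf a)
  have hb := hle _ (hf b)
  simp only [Equiv.swap_apply_left, Equiv.swap_apply_right]
  split_ifs <;> linarith

theorem two_le_of_sum_le {n r : ℕ} (hn : 7 ≤ n) (h : ∑ i ∈ Ico (r + 1) n, (1 : ℝ) / i ≤ 1) :
    2 ≤ r := by
  by_contra! hr
  have hsub : ∑ i ∈ Ico (2 : ℕ) 7, (1 : ℝ) / i ≤ ∑ i ∈ Ico (r + 1) n, (1 : ℝ) / i :=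
    sum_le_sum_of_subset_of_nonneg (Ico_subset_Ico (by omega) hn) fun _ _ _ => by positivity
  norm_num [sum_Ico_succ_top] at hsub
  norm_num at h
  linarith

theorem isDP_pMix {l : ℕ} (hl : 1 ≤ l) {p : unitInterval} (hp : 0 < p) {ε : ℝ} (hε : 0 ≤ ε)
    {n : ℕ} [NeZero n] (hn : 7 ≤ n) (hln : l < n) (σ₀ : CandOrder n) {δ : ℝ}
    (hδ : (if ε < Real.log (qProb p σ₀ 1 / qProb p σ₀ (l + 1))
      then qProb p σ₀ 1 - Real.exp ε * qProb p σ₀ (l + 1) else 0) ≤ δ) :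
    IsDP (lDist l) ε δ (pMix p (secretary n) (blindChoice n)) := by
  classical
  obtain ⟨r, hr0, hrn, hr, hH, hH'⟩ := exists_threshold_eq (by omega : 3 ≤ n)
  have hr2 := two_le_of_sum_le hn hH'
  rw [qProb_eq_mixedProb hr hr0 hrn p σ₀ le_rfl (by omega),
    qProb_eq_mixedProb hr hr0 hrn p σ₀ (by omega : 1 ≤ l + 1) (by omega)] at hδ
  have hn' : (0 : ℝ) < n := by exact_mod_cast (by omega : 0 < n)
  have hr' : (0 : ℝ) < r := by exact_mod_cast hr0
  have hp' : (0 : ℝ) < p := hp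
  have hp1 : (p : ℝ) ≤ 1 := p.2.2
  have ha : 0 < (p : ℝ) * (r / n) := by positivity
  have hb : 0 ≤ (1 - (p : ℝ)) * (1 / n) := mul_nonneg (by linarith) (by positivity)
  set q := mixedProb n r p with hq
  have hpos : ∀ k, 1 ≤ k → k ≤ n → 0 < q k := fun k hk hkn =>
    add_pos_of_pos_of_nonneg (mul_pos ha (scaledProb_pos hr0 hrn hk hkn)) hb
  have hlc : ∀ k, 1 ≤ k → k + 2 ≤ n → q (k + 1) ^ 2 ≤ q k * q (k + 2) := fun k hk hkn =>
    affine_logConvex (scaledProb_pos hr0 hrn hk (by omega)).le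
      (scaledProb_pos hr0 hrn (by omega) (by omega)).le ha.le hb
      (scaledProb_logConvex hn hr2 hrn hH hH' hk hkn)
  have hanti : ∀ i j, 1 ≤ i → i ≤ j → j ≤ n → q j ≤ q i := fun i j hi hij _ =>
    add_le_add_left (mul_le_mul_of_nonneg_left (scaledProb_antitone hrn (by omega) hi hij) ha.le) _
  have key : ∀ i j, 1 ≤ i → i ≤ n → 1 ≤ j → j ≤ n → j ≤ i + l → q i - Real.exp ε * q j ≤ δ :=
    fun i j hi hin hj hjn hij => sub_exp_mul_le_of_logConvex hpos hlc hanti hln hδ hi hin hj hjn hij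
  -- In the first branch the condition on `ε` says precisely that the lower bound for `δ` is
  -- positive.
  have hδ0 : 0 ≤ δ := by
    refine le_trans ?_ hδ
    split_ifs with h
    · have p₂ := hpos (l + 1) (by omega) (by omega)
      rw [Real.lt_log_iff_exp_lt (div_pos (hpos 1 le_rfl (by omega)) p₂), lt_div_iff₀ p₂] at h
      linarith
    · exact le_rfl
  intro S σ ρ hd
  rw [selectProb_eq_sum_mixedProb hr hr0 hrn, selectProb_eq_sum_mixedProb hr hr0 hrn, ← hq]
  have hrank : ∀ c, 1 ≤ rank ρ c ∧ rank ρ c ≤ n := fun c => by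
    have := (ρ.symm c).isLt
    rw [rank]; omega
  have hf : ∀ c, 0 ≤ q (rank ρ c) := fun c => (hpos _ (hrank c).1 (hrank c).2).le
  rcases eq_or_swap_of_lDist_le_one hl hd with rfl | ⟨a, b, hab, hdist, rfl⟩
  · have : 0 ≤ ∑ c : Fin n with c ∈ S, q (rank σ c) := sum_nonneg fun c _ => hf c
    have := le_mul_of_one_le_left this (Real.one_le_exp hε)
    linarith
  · simp_rw [rank_swap_mul]
    rw [Nat.dist] at hdist
    exact sum_swap_le (fun c => q (rank ρ c)) hε hδ0 hf hab
      (key _ _ (hrank a).1 (hrank a).2 (hrank b).1 (hrank b).2 (by omega))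
      (key _ _ (hrank b).1 (hrank b).2 (hrank a).1 (hrank a).2 (by omega)) _

/-! ### Limits as `n → ∞`. -/

/-- The full series `∑ x ^ s / s` at `x = 1 - 1/e` is `-log (1 - x) = 1`. -/
theorem aCoef_eq {k : ℕ} (hk : 1 ≤ k) :
    aCoef k = 1 - ∑ i ∈ Ico 1 k, (1 - 1 / Real.exp 1) ^ i / (i : ℝ) := by
  set x : ℝ := 1 - 1 / Real.exp 1 with hx
  have he : 1 < Real.exp 1 := Real.one_lt_exp_iff.2 one_pos
  have h1 : 1 / Real.exp 1 < 1 := (div_lt_one (by positivity)).2 he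
  have h0 : 0 < 1 / Real.exp 1 := by positivity
  have habs : |x| < 1 := by rw [abs_lt]; constructor <;> linarith
  have hsum := Real.hasSum_pow_div_log_of_abs_lt_one habs
  have hlog : -Real.log (1 - x) = 1 := by simp [hx]
  rw [hlog] at hsum
  have h := hsum.summable.sum_add_tsum_nat_add (k - 1)
  rw [hsum.tsum_eq] at h
  have e₁ : aCoef k = ∑' s : ℕ, x ^ (s + (k - 1) + 1) / (((s + (k - 1) : ℕ) : ℝ) + 1) := by
    rw [aCoef]
    refine tsum_congr fun s => ?_
    rw [show s + (k - 1) + 1 = k + s by omega]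
    have : ((s + (k - 1) : ℕ) : ℝ) + 1 = ((k + s : ℕ) : ℝ) := by
      exact_mod_cast (by omega : s + (k - 1) + 1 = k + s)
    rw [this]
    ring
  have e₂ : ∑ i ∈ Ico 1 k, x ^ i / (i : ℝ) = ∑ i ∈ range (k - 1), x ^ (i + 1) / ((i : ℝ) + 1) := by
    rw [sum_Ico_eq_sum_range]
    refine sum_congr rfl fun i _ => ?_
    rw [add_comm 1 i]
    push_cast
    rfl
  rw [e₁, e₂]
  linarith

theorem tendsto_threshold_sub_one_div :
    Tendsto (fun n : ℕ => ((threshold n - 1 : ℕ) : ℝ) / n) atTop (𝓝 (1 / Real.exp 1)) := by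
  have hinv : Tendsto (fun n : ℕ => (1 : ℝ) / n) atTop (𝓝 0) := tendsto_one_div_atTop_nhds_zero_nat
  have hl : Tendsto (fun n : ℕ => 1 / Real.exp 1 - (1 : ℝ) / n) atTop (𝓝 (1 / Real.exp 1)) := by
    simpa using hinv.const_sub (1 / Real.exp 1)
  have hu : Tendsto (fun n : ℕ => 1 / Real.exp 1 + (1 : ℝ) / n) atTop (𝓝 (1 / Real.exp 1)) := by
    simpa using hinv.const_add (1 / Real.exp 1)
  have he := Real.exp_pos 1
  refine tendsto_of_tendsto_of_tendsto_of_le_of_le' hl hu ?_ ?_ <;>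
  · filter_upwards [eventually_ge_atTop 3] with n hn
    obtain ⟨r, hr0, hrn, hr, hH, hH'⟩ := exists_threshold_eq hn
    have hn' : (0 : ℝ) < n := by exact_mod_cast (by omega : 0 < n)
    have h₁ := le_exp_mul_of_sum_le hrn hH'
    have h₂ := exp_mul_lt_of_lt_sum hr0 hrn hH
    rw [hr, Nat.add_sub_cancel]
    field_simp
    linarith

/-- By minimality of the threshold the sum lies between 1 and `1 + 1 / r`, and `r` grows like `n /
e`. -/
theorem tendsto_harmonic_threshold :
    Tendsto (fun n : ℕ => ∑ s ∈ Ico (threshold n - 1) n, (1 : ℝ) / s) atTop (𝓝 1) := by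
  have hinv : Tendsto (fun n : ℕ => (1 : ℝ) / n) atTop (𝓝 0) := tendsto_one_div_atTop_nhds_zero_nat
  have he : (1 : ℝ) / Real.exp 1 ≠ 0 := by positivity
  have hu : Tendsto (fun n : ℕ => 1 + (1 : ℝ) / n / (((threshold n - 1 : ℕ) : ℝ) / n)) atTop
      (𝓝 1) := by
    simpa using (hinv.div tendsto_threshold_sub_one_div he).const_add 1
  refine tendsto_of_tendsto_of_tendsto_of_le_of_le' tendsto_const_nhds hu ?_ ?_
  · filter_upwards [eventually_ge_atTop 3] with n hn
    obtain ⟨r, hr0, hrn, hr, hH, hH'⟩ := exists_threshold_eq hn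
    rw [hr, Nat.add_sub_cancel]
    exact hH.le
  · filter_upwards [eventually_ge_atTop 3] with n hn
    obtain ⟨r, hr0, hrn, hr, hH, hH'⟩ := exists_threshold_eq hn
    have hn' : (0 : ℝ) < n := by exact_mod_cast (by omega : 0 < n)
    rw [hr, Nat.add_sub_cancel, sum_eq_sum_Ico_succ_bot hrn, div_div_div_cancel_right₀ hn'.ne']
    linarith

theorem tendsto_sub_div_sub {u : ℕ → ℝ} {y : ℝ} (hu : Tendsto (fun n : ℕ => u n / n) atTop (𝓝 y))
    (a b : ℝ) : Tendsto (fun n : ℕ => ((n : ℝ) - u n - a) / (n - b)) atTop (𝓝 (1 - y)) := by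
  have hinv : Tendsto (fun n : ℕ => (1 : ℝ) / n) atTop (𝓝 0) := tendsto_one_div_atTop_nhds_zero_nat
  have h : Tendsto (fun n : ℕ => (1 - u n / n - a * (1 / (n : ℝ))) / (1 - b * (1 / (n : ℝ)))) atTop
      (𝓝 ((1 - y - a * 0) / (1 - b * 0))) :=
    (((tendsto_const_nhds.sub hu).sub (hinv.const_mul a))).div
      (tendsto_const_nhds.sub (hinv.const_mul b)) (by simp)
  simp only [mul_zero, sub_zero, div_one] at h
  refine h.congr' ?_
  filter_upwards [eventually_gt_atTop 0] with n hn
  have hn' : (n : ℝ) ≠ 0 := by exact_mod_cast hn.ne'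
  rw [← mul_div_mul_left _ _ hn']
  congr 1 <;> field_simp

/-- The recursion `dropCoef_succ` multiplies by `k / (k + 1) * ((n - r - k) / (n - 1 - k))`, whose
second factor tends to `1 - 1/e`. -/
theorem tendsto_dropCoef {k : ℕ} (hk : 1 ≤ k) :
    Tendsto (fun n : ℕ => dropCoef n (threshold n - 1) k) atTop
      (𝓝 ((1 - 1 / Real.exp 1) ^ k / (k : ℝ))) := by
  induction k, hk using Nat.le_induction with
  | base =>
    have h := tendsto_sub_div_sub tendsto_threshold_sub_one_div 0 1
    rw [pow_one, Nat.cast_one, div_one]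
    refine h.congr' ?_
    filter_upwards [eventually_ge_atTop 3] with n hn
    obtain ⟨r, hr0, hrn, hr, -, -⟩ := exists_threshold_eq hn
    rw [hr, Nat.add_sub_cancel, dropCoef_one hrn.le (by omega), sub_zero]
  | succ k hk ih =>
    have h := ((tendsto_sub_div_sub tendsto_threshold_sub_one_div k (1 + k)).mul ih).const_mul
      ((k : ℝ) / (k + 1))
    have hk' : (k : ℝ) ≠ 0 := by exact_mod_cast (by omega : k ≠ 0)
    have hlim : (k : ℝ) / (k + 1) * ((1 - 1 / Real.exp 1) * ((1 - 1 / Real.exp 1) ^ k / k)) =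
        (1 - 1 / Real.exp 1) ^ (k + 1) / ((k + 1 : ℕ) : ℝ) := by
      generalize 1 - 1 / Real.exp 1 = x
      push_cast
      field_simp
      ring
    rw [hlim] at h
    refine h.congr' ?_
    filter_upwards [eventually_ge_atTop 3, eventually_gt_atTop (k + 1)] with n hn hkn
    obtain ⟨r, hr0, hrn, hr, -, -⟩ := exists_threshold_eq hn
    rw [hr, Nat.add_sub_cancel]
    have e := dropCoef_succ hrn.le hk hkn
    have hkn' : (k : ℝ) + 1 < n := by exact_mod_cast hkn
    have h₁ : (n : ℝ) - (1 + k) ≠ 0 := by linarith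
    have h₂ : (k : ℝ) + 1 ≠ 0 := by positivity
    rw [← mul_assoc, div_mul_div_comm, div_mul_eq_mul_div, div_eq_iff (mul_ne_zero h₂ h₁)]
    linear_combination -e

theorem tendsto_scaledProb {k : ℕ} (hk : 1 ≤ k) :
    Tendsto (fun n : ℕ => scaledProb n (threshold n - 1) k) atTop (𝓝 (aCoef k)) := by
  have hc : Tendsto (fun n : ℕ => if k = 1 then 0 else 1 / ((n : ℝ) - 1)) atTop (𝓝 0) := by
    split_ifs
    · exact tendsto_const_nhds
    · refine tendsto_const_nhds.div_atTop ?_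
      exact tendsto_atTop_add_const_right _ _ tendsto_natCast_atTop_atTop
  have hs : Tendsto (fun n : ℕ => ∑ i ∈ Ico 1 k, dropCoef n (threshold n - 1) i) atTop
      (𝓝 (∑ i ∈ Ico 1 k, (1 - 1 / Real.exp 1) ^ i / (i : ℝ))) :=
    tendsto_finsetSum _ fun i hi => tendsto_dropCoef (mem_Ico.1 hi).1
  rw [aCoef_eq hk, ← add_zero (1 - _)]
  exact (tendsto_harmonic_threshold.sub hs).add hc

theorem tendsto_qProb (p : unitInterval) (σ : (n : ℕ+) → CandOrder n) {k : ℕ} (hk : 1 ≤ k) :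
    Tendsto (fun n : ℕ+ => qProb p (σ n) k) atTop (𝓝 ((p : ℝ) / Real.exp 1 * aCoef k)) := by
  have h : Tendsto (fun n : ℕ => mixedProb n (threshold n - 1) p k) atTop
      (𝓝 ((p : ℝ) / Real.exp 1 * aCoef k)) := by
    have := ((tendsto_threshold_sub_one_div.const_mul (p : ℝ)).mul (tendsto_scaledProb hk)).add
      (tendsto_one_div_atTop_nhds_zero_nat.const_mul (1 - (p : ℝ)))
    rw [mul_zero, add_zero, mul_one_div] at this
    exact this
  refine (h.comp tendsto_PNat_val_atTop_atTop).congr' ?_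
  filter_upwards [tendsto_PNat_val_atTop_atTop.eventually_ge_atTop 3,
    tendsto_PNat_val_atTop_atTop.eventually_ge_atTop k] with n hn hkn
  obtain ⟨r, hr0, hrn, hr, -, -⟩ := exists_threshold_eq hn
  rw [qProb_eq_mixedProb hr hr0 hrn p (σ n) hk hkn, Function.comp_apply, hr, Nat.add_sub_cancel]

end SecretaryDP

theorem mainTheorem8 (l : ℕ) (hl : 1 ≤ l) (p : unitInterval) (hp : 0 < p)
    (ε : ℝ) (hε : 0 ≤ ε) :
    (∀ (n : ℕ) [NeZero n], 7 ≤ n → l < n → ∀ (σ : CandOrder n) (δ : ℝ),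
      (if ε < Real.log (qProb p σ 1 / qProb p σ (l + 1))
        then qProb p σ 1 - Real.exp ε * qProb p σ (l + 1) else 0) ≤ δ →
      IsDP (lDist l) ε δ (pMix p (secretary n) (blindChoice n))) ∧
    (∀ σ : (n : ℕ+) → CandOrder n,
      Tendsto (fun n : ℕ+ => qProb p (σ n) 1 - Real.exp ε * qProb p (σ n) (l + 1)) atTop
        (𝓝 ((p : ℝ) / Real.exp 1 * (1 - aCoef (l + 1) * Real.exp ε))) ∧
      (aCoef (l + 1) * Real.exp ε ≠ 1 →
        Tendsto (fun n : ℕ+ => (qProb p (σ n) 1 - Real.exp ε * qProb p (σ n) (l + 1)) /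
          ((p : ℝ) / Real.exp 1 * (1 - aCoef (l + 1) * Real.exp ε))) atTop (𝓝 1))) := by
  refine ⟨fun n _ hn hln σ δ hδ => isDP_pMix hl hp hε hn hln σ hδ, fun σ => ?_⟩
  have hlim : Tendsto (fun n : ℕ+ => qProb p (σ n) 1 - Real.exp ε * qProb p (σ n) (l + 1)) atTop
      (𝓝 ((p : ℝ) / Real.exp 1 * (1 - aCoef (l + 1) * Real.exp ε))) := by
    have h := (tendsto_qProb p σ le_rfl).sub
      ((tendsto_qProb p σ (by omega : 1 ≤ l + 1)).const_mul (Real.exp ε))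
    have h1 : aCoef 1 = 1 := by simp [aCoef_eq le_rfl]
    rw [h1] at h
    convert h using 2
    ring
  refine ⟨hlim, fun hne => ?_⟩
  have hp' : (p : ℝ) ≠ 0 := (show (0 : ℝ) < p from hp).ne'
  have hL : (p : ℝ) / Real.exp 1 * (1 - aCoef (l + 1) * Real.exp ε) ≠ 0 :=
    mul_ne_zero (div_ne_zero hp' (Real.exp_ne_zero 1)) (sub_ne_zero.2 hne.symm)
  simpa [div_self hL] using hlim.div_const ((p : ℝ) / Real.exp 1 * (1 - aCoef (l + 1) * Real.exp ε))
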